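/- Let $\mathcal C$ be a triangulated category with all small coproducts (a smashing category), and write $\mathcal C(X,Y)$ for its morphism groups. Weight structures and $t$-structures are in the homological convention. **Definitions.** For a class $\mathcal P$ of objects, a morphism $h$ is *$\mathcal P$-null* if $\mathcal C(P,h)=0$ for all $P\in\mathcal P$, and *$\mathcal P$-conull* if $\mathcal C(h,P)=0$ for all $P\in\mathcal P$. The class $\mathcal P$ is *perfect* if the $\mathcal P$-null morphisms are closed under small coproducts, and *symmetric* to a class $\mathcal Q$ if the $\mathcal P$-null morphisms are exactly the $\mathcal Q$-conull ones. An object $P$ is *compact* if $\mathcal C(P,-)\colon\mathcal C\to\mathrm{Ab}$ respects small coproducts. A *Brown–Comenetz dual* $\hat P$ of $P$ is an object representing the functor $M\mapsto \mathrm{Ab}(\mathcal C(P,M),\mathbb Q/\mathbb Z)$, $\mathcal C^{op}\to\mathrm{Ab}$; put $\hat{\mathcal P}=\{\hat P: P\in\mathcal P\}$ (objects taken up to isomorphism). $\mathcal C$ satisfies *Brown representability* if every cohomological functor $\mathcal C^{op}\to \mathrm{Ab}$ that converts small coproducts into products is representable. A *weight structure* $w$ on a triangulated category is a pair of retraction-closed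 classes $(\mathcal C_{w\le 0},\mathcal C_{w\ge 0})$ with $\mathcal C_{w\le 0}\subset\mathcal C_{w\le 0}[1]$, $\mathcal C_{w\ge 0}[1]\subset\mathcal C_{w\ge 0}$, $\mathcal C_{w\le 0}\perp\mathcal C_{w\ge 0}[1]$, and such that each $M$ fits into a distinguished triangle $L\to M\to R[1]\to L[1]$ with $L\in\mathcal C_{w\le 0}$, $R\in\mathcal C_{w\ge 0}$. It is *generated* by a class $\mathcal G$ if $\mathcal C_{w\ge 0}=(\bigcup_{i>0}\mathcal G[-i])^{\perp}$; it is *cosmashing* if small products exist and $\mathcal C_{w\le 0}$ is closed under them; its heart $\underline{Hw}$ is the full subcategory on $\mathcal C_{w=0}=\mathcal C_{w\le 0}\cap\mathcal C_{w\ge 0}$. The *opposite* of a weight structure is the weight structure on the opposite category obtained by exchanging the two classes. A $t$-structure $t$ is *generated* by $\mathcal P$ if $\mathcal C_{t\le 0}=(\bigcup_{i>0}\mathcal P[i])^{\perp}$, and *compactly generated* if it is generated by a set of compact objects. Its heart is $\underline{Ht}$, and $H^t=t_{\le 0}\circ t_{\ge 0}\colon\mathcal C\to\underline{Ht}$ is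 the zeroth homology functor. A weight structure $w$ is *right adjacent* to $t$ if $\mathcal C_{w\le 0}=\mathcal C_{t\le 0}$. **Theorem.** Let $\mathcal P$ be a class of objects of $\mathcal C$. I.1. If $\mathcal P$ is symmetric to some class of objects of $\mathcal C$, then $\mathcal P$ is perfect. I.2. If $\hat P$ exists for every $P\in\mathcal P$, then $\mathcal P$ is symmetric to $\hat{\mathcal P}$. II. Assume in addition that $\mathcal C$ satisfies Brown representability and that all elements of $\mathcal P$ are compact. II.1. Then $\hat P$ exists for every $P\in\mathcal P$, so $\mathcal P$ is symmetric to $\hat{\mathcal P}$; moreover $\mathcal C^{op}$ has all small coproducts and $\hat{\mathcal P}$ is perfect in $\mathcal C^{op}$. II.2. Suppose furthermore that $\mathcal P$ is a set. Then $\hat{\mathcal P}$ is (up to isomorphism) a set, $\mathcal P$ generates a $t$-structure $t$ on $\mathcal C$, and $\hat{\mathcal P}$ generates a weight structure $w^{op}$ on $\mathcal C^{op}$. The opposite weight structure $w$ on $\mathcal C$ is cosmashing, the class $\mathcal C_{w=0}$ is closed under small products in $\mathcal C$, and $w$ is right adjacent to $t$. II.3. In the situation of II.2, $H^t$ restricts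 to an equivalence of $\underline{Hw}$ with the full subcategory of injective objects of $\underline{Ht}$. Moreover, there is $I_w\in\mathcal C_{w=0}$ such that every element of $\mathcal C_{w=0}$ is a retract of a (small) product of copies of $I_w$, and $H^t(I_w)$ is an injective cogenerator of $\underline{Ht}$. **Corollary.** If $t$ is a compactly generated $t$-structure on a triangulated category $\mathcal C$ with small coproducts, then $\underline{Ht}$ has an injective cogenerator. -/

import Mathlib

open CategoryTheory CategoryTheory.Limits CategoryTheory.Pretriangulated
open CategoryTheory.Triangulated Opposite
open scoped CategoryTheory.Pretriangulated.Opposite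

universe v u

namespace CategoryTheory

/-! ### Null morphisms, perfect classes, symmetric classes -/

section Preadditive

variable {C : Type u} [Category.{v} C] [Preadditive C]

/-- The `𝒮`-null morphisms: those `h` such that `C(P, h) = 0` for every `P` in `𝒮`. -/
def ObjectProperty.nullMorphisms (𝒮 : ObjectProperty C) : MorphismProperty C :=
  fun X _ h => ∀ ⦃P : C⦄, 𝒮 P → ∀ g : P ⟶ X, g ≫ h = 0

/-- The `𝒬`-conull morphisms: those `h` such that `C(h, Q) = 0` for every `Q` in `𝒬`. -/
def ObjectProperty.conullMorphisms (𝒬 : ObjectProperty C) : MorphismProperty C :=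
  fun _ Y h => ∀ ⦃Q : C⦄, 𝒬 Q → ∀ g : Y ⟶ Q, h ≫ g = 0

/-- `𝒮` is perfect if the class of `𝒮`-null morphisms is closed under small coproducts. -/
def ObjectProperty.IsPerfect (𝒮 : ObjectProperty C) : Prop :=
  MorphismProperty.IsStableUnderCoproducts.{v} 𝒮.nullMorphisms

/-- `𝒮` is symmetric to `𝒬` if the `𝒮`-null morphisms are exactly the `𝒬`-conull ones. -/
def ObjectProperty.IsSymmetricTo (𝒮 𝒬 : ObjectProperty C) : Prop :=
  𝒮.nullMorphisms = 𝒬.conullMorphisms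

/-- `P` is compact if `C(P, -) : C ⥤ Ab` respects small coproducts. -/
def IsCompactObj (P : C) : Prop :=
  ∀ J : Type v, PreservesColimitsOfShape (Discrete J) (preadditiveCoyoneda.obj (op P))

/-- The group `ℚ / ℤ`, in the universe of the morphisms of `C`. -/
noncomputable def ratModInt : AddCommGrpCat.{v} :=
  AddCommGrpCat.of (ULift.{v} (AddCircle (1 : ℚ)))

/-- The functor `M ↦ Ab(C(P, M), ℚ / ℤ)` from `Cᵒᵖ` to abelian groups. -/
noncomputable def brownComenetzFunctor (P : C) : Cᵒᵖ ⥤ AddCommGrpCat.{v} :=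
  (preadditiveCoyoneda.obj (op P)).op ⋙ preadditiveYoneda.obj ratModInt.{v}

/-- `X` is a Brown–Comenetz dual of `P` if it represents `M ↦ Ab(C(P, M), ℚ / ℤ)`. -/
def IsBrownComenetzDual (P X : C) : Prop :=
  Nonempty (preadditiveYoneda.obj X ≅ brownComenetzFunctor P)

/-- The class of all Brown–Comenetz duals of elements of `𝒮`. -/
def ObjectProperty.brownComenetzDuals (𝒮 : ObjectProperty C) : ObjectProperty C :=
  fun X => ∃ P : C, 𝒮 P ∧ IsBrownComenetzDual P X

variable [HasShift C ℤ]

/-- The class `⋃_{i > 0} 𝒮[i]` (up to isomorphism). -/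
def ObjectProperty.positiveShifts (𝒮 : ObjectProperty C) : ObjectProperty C :=
  fun X => ∃ i : ℤ, 0 < i ∧ ∃ P : C, 𝒮 P ∧ Nonempty (X ≅ P⟦i⟧)

/-- The class `⋃_{i > 0} 𝒮[-i]` (up to isomorphism). -/
def ObjectProperty.negativeShifts (𝒮 : ObjectProperty C) : ObjectProperty C :=
  fun X => ∃ i : ℤ, 0 < i ∧ ∃ P : C, 𝒮 P ∧ Nonempty (X ≅ P⟦-i⟧)

end Preadditive

variable (C : Type u) [Category.{v} C] [Preadditive C] [HasZeroObject C] [HasShift C ℤ]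
  [∀ n : ℤ, (shiftFunctor C n).Additive] [Pretriangulated C]

/-- Brown representability (for a category with small coproducts): every cohomological functor
from `C` to abelian groups that converts small coproducts into products is representable.
(Products in `Cᵒᵖ` are coproducts in `C`.) -/
def BrownRepresentability : Prop :=
  ∀ H : Cᵒᵖ ⥤ AddCommGrpCat.{v}, H.IsHomological →
    (∀ J : Type v, PreservesLimitsOfShape (Discrete J) H) →
    ∃ X : C, Nonempty (preadditiveYoneda.obj X ≅ H)

/-! ### Weight structures -/

/-- A weight structure, in the homological convention: `le` is the class `C_{w ≤ 0}` and
`ge` is the class `C_{w ≥ 0}`. -/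
structure WeightStructure where
  le : ObjectProperty C
  ge : ObjectProperty C
  le_retract : le.IsStableUnderRetracts
  ge_retract : ge.IsStableUnderRetracts
  /-- `C_{w ≤ 0} ⊆ C_{w ≤ 0}[1]`. -/
  le_shift : ∀ X : C, le X → le (X⟦(-1 : ℤ)⟧)
  /-- `C_{w ≥ 0}[1] ⊆ C_{w ≥ 0}`. -/
  ge_shift : ∀ X : C, ge X → ge (X⟦(1 : ℤ)⟧)
  orthogonal : ∀ ⦃X Y : C⦄, le X → ge Y → ∀ f : X ⟶ Y⟦(1 : ℤ)⟧, f = 0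
  exists_decomposition : ∀ M : C, ∃ (L R : C) (_ : le L) (_ : ge R)
    (f : L ⟶ M) (g : M ⟶ R⟦(1 : ℤ)⟧) (h : R⟦(1 : ℤ)⟧ ⟶ L⟦(1 : ℤ)⟧),
    Triangle.mk f g h ∈ distTriang C

variable {C}

namespace WeightStructure

/-- The heart of a weight structure, as a class of objects. -/
def heart (w : WeightStructure C) : ObjectProperty C := w.le ⊓ w.ge

/-- `𝒮` generates `w` if `C_{w ≥ 0} = (⋃_{i > 0} 𝒮[-i])^⊥`. -/
def IsGeneratedBy (w : WeightStructure C) (𝒮 : ObjectProperty C) : Prop :=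
  w.ge = 𝒮.negativeShifts.rightOrthogonal

/-- `w` is cosmashing if `C` has small products and `C_{w ≤ 0}` is closed under them. -/
def IsCosmashing (w : WeightStructure C) : Prop :=
  HasProducts.{v} C ∧ ∀ J : Type v, w.le.IsClosedUnderLimitsOfShape (Discrete J)

/-- `w` is right adjacent to a t-structure `t` if `C_{w ≤ 0} = C_{t ≤ 0}`. (Mathlib indexes
t-structures cohomologically: the homological class `C_{t ≤ 0}` is `t.ge 0`.) -/
def IsRightAdjacent (w : WeightStructure C) (t : TStructure C) : Prop :=
  w.le = t.ge 0

end WeightStructure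

/-- The weight structure on `C` opposite to a weight structure on `Cᵒᵖ`: the two classes are
exchanged. -/
def WeightStructure.unop (w : WeightStructure Cᵒᵖ) : WeightStructure C where
  le := w.ge.unop
  ge := w.le.unop
  le_retract := ⟨fun r hY => w.ge_retract.of_retract r.op hY⟩
  ge_retract := ⟨fun r hY => w.le_retract.of_retract r.op hY⟩
  le_shift X hX := w.ge_shift (op X) hX
  ge_shift X hX := w.le_shift (op X) hX
  orthogonal X Y hX hY f := by
    have h := w.orthogonal (X := op Y) (Y := op X) hY hX
      ((f⟦(-1 : ℤ)⟧' ≫ (shiftShiftNeg Y (1 : ℤ)).hom).op)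
    have h' : f⟦(-1 : ℤ)⟧' ≫ (shiftShiftNeg Y (1 : ℤ)).hom = 0 := Quiver.Hom.op_inj h
    apply (shiftFunctor C (-1 : ℤ)).map_injective
    rw [Functor.map_zero, ← cancel_mono (shiftShiftNeg Y (1 : ℤ)).hom, h', zero_comp]
  exists_decomposition M := by
    obtain ⟨L, R, hL, hR, f, g, h, hT⟩ := w.exists_decomposition (op (M⟦(-1 : ℤ)⟧))
    have hT' := Triangle.shift_distinguished _ (unop_distinguished _ hT) 1
    generalize hS : (shiftFunctor (Triangle C) (1 : ℤ)).obj
      ((triangleOpEquivalence C).inverse.obj (Triangle.mk f g h)).unop = S at hT'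
    have e₁ : S.obj₁ ≅ R.unop := by subst hS; exact shiftNegShift R.unop (1 : ℤ)
    have e₂ : S.obj₂ ≅ M := by subst hS; exact shiftNegShift M (1 : ℤ)
    have e₃ : S.obj₃ ≅ L.unop⟦(1 : ℤ)⟧ := by subst hS; exact Iso.refl _
    refine ⟨R.unop, L.unop, hR, hL, e₁.inv ≫ S.mor₁ ≫ e₂.hom, e₂.inv ≫ S.mor₂ ≫ e₃.hom,
      e₃.inv ≫ S.mor₃ ≫ e₁.hom⟦(1 : ℤ)⟧', isomorphic_distinguished _ hT' _ ?_⟩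
    have h₁ : (e₁.inv ≫ S.mor₁ ≫ e₂.hom) ≫ e₂.inv = e₁.inv ≫ S.mor₁ := by simp
    have h₂ : (e₂.inv ≫ S.mor₂ ≫ e₃.hom) ≫ e₃.inv = e₂.inv ≫ S.mor₂ := by simp
    have h₃ : (e₃.inv ≫ S.mor₃ ≫ e₁.hom⟦(1 : ℤ)⟧') ≫ e₁.inv⟦(1 : ℤ)⟧' = e₃.inv ≫ S.mor₃ := by
      simp [← Functor.map_comp]
    exact Triangle.isoMk _ _ e₁.symm e₂.symm e₃.symm h₁ h₂ h₃

/-! ### t-structures -/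

namespace Triangulated.TStructure

variable (t : TStructure C)

/-- `𝒮` generates `t` if `C_{t ≤ 0} = (⋃_{i > 0} 𝒮[i])^⊥`, where the homological class
`C_{t ≤ 0}` is `t.ge 0`. -/
def IsGeneratedBy (𝒮 : ObjectProperty C) : Prop :=
  t.ge 0 = 𝒮.positiveShifts.rightOrthogonal

/-- `t` is compactly generated if it is generated by a set of compact objects. -/
def IsCompactlyGenerated : Prop :=
  ∃ 𝒮 : ObjectProperty C, ObjectProperty.Small.{v} 𝒮 ∧ (∀ P, 𝒮 P → IsCompactObj P) ∧
    t.IsGeneratedBy 𝒮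

/-- The zeroth homology functor `H^t = t_{≤ 0} ∘ t_{≥ 0}` with values in the heart. -/
noncomputable def heartHomology [IsTriangulated C] : C ⥤ t.heart.FullSubcategory :=
  t.heart.lift (t.truncGELE 0 0) fun _ => (t.mem_heart_iff _).2 ⟨inferInstance, inferInstance⟩

end Triangulated.TStructure

end CategoryTheory

namespace CategoryTheory

/-! ### Null and conull morphisms, characters, Brown–Comenetz duals -/

section Preadditive

variable {C : Type u} [Category.{v} C] [Preadditive C]

/-! Conullness concerns maps out of the target, so on a coproduct it is tested summand by summand.
Hence a class symmetric to another is perfect, and, symmetry being self-dual, the other class is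
perfect in `Cᵒᵖ`. Since ℚ/ℤ is an injective cogenerator of abelian groups, a morphism dies under
`C(P, -)` iff it dies under `C(-, X)` for a dual `X` of `P`. If `P` is compact, the functor that a
dual must represent is cohomological and turns coproducts into products, so Brown representability
supplies the dual. Products and split idempotents arise in the same way.

One cell-attaching construction, `IsBrownFunctor.exists_killing`, produces everything else that has
to exist. Cone off all maps from a set of generators that annihilate a given element of a Brown
functor `H`, repeat, and take the homotopy colimit. For `H = 0` this yields the truncation triangles
of the t-structure (compact generators) and of the weight structure on `Cᵒᵖ` (perfect generators).
For arbitrary `H` it yields Neeman's Brown representability theorem.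

The positive shifts of the class and of its duals are again symmetric; applied to identity morphisms
this says that `w.le` is `t.ge 0`, which is adjacency. If `X` is in the heart of `w`, maps from
`t.ge 0` to `X⟦1⟧` vanish. So maps to `X` extend along monomorphisms of the heart of `t`, and `Hᵗ X`
is injective; the same vanishing makes `Hᵗ` fully faithful on the heart of `w`. A weight
decomposition embeds an injective `J` into some `Hᵗ R`, and splitting the resulting idempotent in
`C` realizes `J`. The cogenerator is the product of weight-zero objects approximating the duals.

For the corollary Brown representability of `C` is not assumed. The localizing subcategory generated
by the compact generators satisfies it by Neeman's theorem and contains `t.le 0`, so it carries an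
induced t-structure with the same heart. -/

lemma ObjectProperty.isStableUnderCoproducts_conullMorphisms (𝒬 : ObjectProperty C) :
    MorphismProperty.IsStableUnderCoproducts.{v} 𝒬.conullMorphisms where
  isStableUnderCoproductsOfShape J :=
    ⟨fun X₁ X₂ c₁ c₂ h₁ h₂ f hf φ hφ Q hQ g => h₁.hom_ext fun j => by
      rw [← Category.assoc, hφ, Category.assoc, hf j hQ, comp_zero]⟩

lemma ObjectProperty.IsSymmetricTo.isPerfect {𝒮 𝒬 : ObjectProperty C}
    (h : 𝒮.IsSymmetricTo 𝒬) : 𝒮.IsPerfect := by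
  rw [IsPerfect, show 𝒮.nullMorphisms = 𝒬.conullMorphisms from h]
  exact 𝒬.isStableUnderCoproducts_conullMorphisms

/-- Passing to `Cᵒᵖ` exchanges null and conull morphisms, so the symmetry can be read from the other
side. -/
lemma ObjectProperty.IsSymmetricTo.isPerfect_op {𝒮 𝒬 : ObjectProperty C}
    (h : 𝒮.IsSymmetricTo 𝒬) : 𝒬.op.IsPerfect := by
  suffices 𝒬.op.nullMorphisms = 𝒮.op.conullMorphisms by
    rw [IsPerfect, this]
    exact 𝒮.op.isStableUnderCoproducts_conullMorphisms
  ext X Y f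
  have := congr_fun (congr_fun (congr_fun (show 𝒮.nullMorphisms = _ from h) Y.unop) X.unop) f.unop
  constructor
  · intro hf Q hQ g
    exact Quiver.Hom.unop_inj ((this.symm ▸ (fun P hP g => Quiver.Hom.op_inj
      (hf (P := op P) hP g.op)) : 𝒮.nullMorphisms f.unop) hQ g.unop)
  · intro hf P hP g
    exact Quiver.Hom.unop_inj ((this ▸ (fun P hP g => Quiver.Hom.op_inj
      (hf (Q := op P) hP g.op)) : 𝒬.conullMorphisms f.unop) hP g.unop)

/-- Homomorphisms to `ℚ / ℤ`, with the universe lift removed. -/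
noncomputable def homRatModIntEquiv (A : AddCommGrpCat.{v}) :
    (A ⟶ ratModInt.{v}) ≃+ (A →+ AddCircle (1 : ℚ)) where
  toFun φ := AddEquiv.ulift.toAddMonoidHom.comp φ.hom
  invFun φ := AddCommGrpCat.ofHom (AddEquiv.ulift.symm.toAddMonoidHom.comp φ)
  left_inv _ := rfl
  right_inv _ := rfl
  map_add' _ _ := rfl

/-- Brown–Comenetz duality in terms of homomorphisms of abelian groups. -/
lemma IsBrownComenetzDual.exists_addEquiv {P X : C} (h : IsBrownComenetzDual P X) :
    ∃ χ : ∀ M : C, (M ⟶ X) ≃+ ((P ⟶ M) →+ AddCircle (1 : ℚ)),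
      ∀ (M N : C) (a : M ⟶ N) (f : N ⟶ X) (u : P ⟶ M), χ M (a ≫ f) u = χ N f (u ≫ a) := by
  obtain ⟨e⟩ := h
  refine ⟨fun M => (e.app (op M)).addCommGroupIsoToAddEquiv.trans
    (homRatModIntEquiv ((preadditiveCoyoneda.obj (op P)).obj M)), fun M N a f u => ?_⟩
  have := ConcreteCategory.congr_hom (e.hom.naturality a.op) f
  exact DFunLike.congr_fun
    (congr_arg (homRatModIntEquiv ((preadditiveCoyoneda.obj (op P)).obj M)) this) u

/-- The group `ℚ / ℤ` is injective. -/
lemma exists_character_extension {A B : Type*} [AddCommGroup A] [AddCommGroup B]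
    (i : A →+ B) (hi : Function.Injective i) (φ : A →+ AddCircle (1 : ℚ)) :
    ∃ ψ : B →+ AddCircle (1 : ℚ), ψ.comp i = φ := by
  obtain ⟨ψ, hψ⟩ := CharacterModule.dual_surjective_of_injective i.toIntLinearMap hi φ
  exact ⟨ψ, hψ⟩

/-- Characters of `B` that vanish on the image of `A` factor through `B ⟶ D` if
`A ⟶ B ⟶ D` is exact. -/
lemma exists_character_descent {A B D : Type*} [AddCommGroup A] [AddCommGroup B] [AddCommGroup D]
    (i : A →+ B) (p : B →+ D) (hip : ∀ b, p b = 0 → ∃ a, i a = b)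
    (φ : B →+ AddCircle (1 : ℚ)) (hφ : φ.comp i = 0) :
    ∃ ψ : D →+ AddCircle (1 : ℚ), ψ.comp p = φ := by
  have hker : p.ker ≤ φ.ker := fun b hb => by
    obtain ⟨a, rfl⟩ := hip b hb
    exact DFunLike.congr_fun hφ a
  -- By exactness the character lives on `B / ker p`, which embeds in `D`; injectivity of ℚ/ℤ
  -- extends it.
  obtain ⟨ψ, hψ⟩ := exists_character_extension (QuotientAddGroup.kerLift p)
    (QuotientAddGroup.kerLift_injective p) (QuotientAddGroup.lift p.ker φ hker)
  exact ⟨ψ, AddMonoidHom.ext fun b => DFunLike.congr_fun hψ (QuotientAddGroup.mk b)⟩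

lemma exists_character_ne_zero {A : Type*} [AddCommGroup A] {a : A} (ha : a ≠ 0) :
    ∃ φ : A →+ AddCircle (1 : ℚ), φ a ≠ 0 :=
  CharacterModule.exists_character_apply_ne_zero_of_ne_zero ha

/-- A morphism is annihilated by all morphisms from `P` iff it is annihilated by all morphisms to
a Brown–Comenetz dual of `P`. -/
lemma IsBrownComenetzDual.comp_eq_zero_iff {P X : C} (hX : IsBrownComenetzDual P X)
    {M N : C} (h : M ⟶ N) : (∀ g : P ⟶ M, g ≫ h = 0) ↔ ∀ g : N ⟶ X, h ≫ g = 0 := by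
  obtain ⟨χ, hχ⟩ := hX.exists_addEquiv
  constructor
  · intro H g
    apply (χ M).injective
    ext u
    rw [hχ, H, map_zero, map_zero, AddMonoidHom.zero_apply]
  · intro H g
    by_contra hg
    obtain ⟨φ, hφ⟩ := exists_character_ne_zero hg
    apply hφ
    have := hχ _ _ h ((χ N).symm φ) g
    rw [H, map_zero, AddEquiv.apply_symm_apply] at this
    exact this.symm

lemma IsBrownComenetzDual.eq_zero_iff {P X : C} (hX : IsBrownComenetzDual P X)
    (M : C) : (∀ g : P ⟶ M, g = 0) ↔ ∀ g : M ⟶ X, g = 0 := by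
  simpa using hX.comp_eq_zero_iff (𝟙 M)

/-- If every morphism to a dual of `P` extends along `h`, then `h` is injective on `C(P, -)`. -/
lemma IsBrownComenetzDual.eq_zero_of_comp_eq_zero {P X : C} (hX : IsBrownComenetzDual P X)
    {M N : C} (h : M ⟶ N) (hh : ∀ f : M ⟶ X, ∃ f' : N ⟶ X, h ≫ f' = f)
    (u : P ⟶ M) (hu : u ≫ h = 0) : u = 0 := by
  obtain ⟨χ, hχ⟩ := hX.exists_addEquiv
  by_contra hne
  obtain ⟨φ, hφ⟩ := exists_character_ne_zero hne
  obtain ⟨f', hf'⟩ := hh ((χ M).symm φ)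
  have := hχ _ _ h f' u
  rw [hf', AddEquiv.apply_symm_apply, hu, map_zero] at this
  exact hφ this

lemma ObjectProperty.isSymmetricTo_brownComenetzDuals (𝒮 : ObjectProperty C)
    (h : ∀ P, 𝒮 P → ∃ X, IsBrownComenetzDual P X) :
    𝒮.IsSymmetricTo 𝒮.brownComenetzDuals := by
  ext M N f
  constructor
  · rintro hf Q ⟨P, hP, hQ⟩
    exact (hQ.comp_eq_zero_iff f).1 (hf hP)
  · intro hf P hP
    obtain ⟨X, hX⟩ := h P hP
    exact (hX.comp_eq_zero_iff f).2 (hf ⟨P, hP, hX⟩)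

lemma IsBrownComenetzDual.nonempty_iso {P X Y : C} (hX : IsBrownComenetzDual P X)
    (hY : IsBrownComenetzDual P Y) : Nonempty (X ≅ Y) := by
  obtain ⟨e⟩ := hX
  obtain ⟨f⟩ := hY
  exact ⟨preadditiveYoneda.preimageIso (e ≪≫ f.symm)⟩

/-- The universal element of a representation, and what it means to be one. -/
lemma exists_universal_element {X : C} {H : Cᵒᵖ ⥤ AddCommGrpCat.{v}}
    (h : Nonempty (preadditiveYoneda.obj X ≅ H)) :
    ∃ η : H.obj (op X), ∀ (M : C) (x : H.obj (op M)), ∃! f : M ⟶ X, H.map f.op η = x := by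
  obtain ⟨e⟩ := h
  have key : ∀ (M : C) (f : M ⟶ X),
      H.map f.op (e.hom.app (op X) (𝟙 X)) = e.hom.app (op M) f := fun M f => by
    have := ConcreteCategory.congr_hom (e.hom.naturality f.op) (𝟙 X)
    refine this.symm.trans (congr_arg (e.hom.app (op M)) ?_)
    exact Category.comp_id f
  refine ⟨e.hom.app (op X) (𝟙 X), fun M x => ?_⟩
  simp only [key]
  exact (e.app (op M)).addCommGroupIsoToAddEquiv.bijective.existsUnique x

end Preadditive
end CategoryTheory

namespace CategoryTheory

/-! ### Brown functors; idempotents, products and duals from Brown representability -/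

section BrownFunctors

variable {C : Type u} [Category.{v} C] [Preadditive C] [HasZeroObject C] [HasShift C ℤ]
  [∀ n : ℤ, (shiftFunctor C n).Additive] [Pretriangulated C]

/-- The conditions in Brown representability, in terms of elements. -/
structure IsBrownFunctor (H : Cᵒᵖ ⥤ AddCommGrpCat.{v}) : Prop where
  exact : ∀ T ∈ distTriang C, ∀ x : H.obj (op T.obj₂), H.map T.mor₁.op x = 0 →
    ∃ y : H.obj (op T.obj₃), H.map T.mor₂.op y = x
  existsUnique : ∀ (J : Type v) (X : J → C) (c : Cofan X) (_ : IsColimit c)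
    (x : ∀ j, H.obj (op (X j))), ∃! y : H.obj (op c.pt), ∀ j, H.map (c.inj j).op y = x j

lemma existsUnique_of_isLimit_fan {J : Type v} {F : J → AddCommGrpCat.{v}} {c : Fan F}
    (hc : IsLimit c) (x : ∀ j, F j) : ∃! y : c.pt, ∀ j, c.proj j y = x j := by
  have h := isLimitOfPreserves (forget AddCommGrpCat.{v}) hc
  let s : (Discrete.functor F ⋙ forget AddCommGrpCat.{v}).sections :=
    ⟨fun j => x j.as, by
      rintro ⟨i⟩ ⟨j⟩ f
      obtain rfl : i = j := Discrete.eq_of_hom f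
      obtain rfl : f = 𝟙 _ := Subsingleton.elim _ _
      simp⟩
  refine ⟨(Types.isLimitEquivSections h).symm s, fun j => ?_, fun y hy => ?_⟩
  · exact Types.isLimitEquivSections_symm_apply h s ⟨j⟩
  · apply (Types.isLimitEquivSections h).injective
    rw [Equiv.apply_symm_apply]
    ext ⟨j⟩
    exact hy j

lemma isBrownFunctor_of_preserves (H : Cᵒᵖ ⥤ AddCommGrpCat.{v}) [H.IsHomological]
    [∀ J : Type v, PreservesLimitsOfShape (Discrete J) H] : IsBrownFunctor H where
  exact T hT x hx := by
    have := H.map_distinguished_op_exact T hT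
    rw [ShortComplex.ab_exact_iff] at this
    exact this x hx
  existsUnique J X c hc x :=
    existsUnique_of_isLimit_fan (isLimitFanMkObjOfIsLimit H _ _ (Cofan.IsColimit.op hc)) x

namespace IsBrownFunctor

variable {H : Cᵒᵖ ⥤ AddCommGrpCat.{v}} (hH : IsBrownFunctor H)
include hH

lemma isHomological [H.PreservesZeroMorphisms] : H.IsHomological where
  exact T hT := by
    rw [ShortComplex.ab_exact_iff]
    exact fun x hx => hH.exact _ (unop_distinguished T hT) x hx

lemma preservesLimitsOfShape [HasCoproducts.{v} C] (J : Type v) :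
    PreservesLimitsOfShape (Discrete J) H where
  preservesLimit {K} := by
    have key := hH.existsUnique J (fun j => (K.obj ⟨j⟩).unop) _ (coproductIsCoproduct _)
    choose y hy hy' using key
    have hlim : IsLimit (Fan.mk (H.obj (op (∐ fun j => (K.obj ⟨j⟩).unop)))
        (fun j => H.map (Sigma.ι (fun j => (K.obj ⟨j⟩).unop) j).op)) := by
      refine Fan.IsLimit.mk _ (fun s => AddCommGrpCat.ofHom (AddMonoidHom.mk'
        (fun a => y fun j => s.proj j a) fun a b => ?_)) (fun s j => ?_) (fun s m hm => ?_)
      · refine (hy' _ _ fun j => ?_).symm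
        simp only [map_add]
        exact congr_arg₂ _ (hy _ j) (hy _ j)
      · ext a
        exact hy _ j
      · ext a
        refine hy' _ _ fun j => ?_
        rw [← hm j]
        rfl
    have : PreservesLimit (Discrete.functor fun j : J => op (K.obj ⟨j⟩).unop) H :=
      preservesLimit_of_preserves_limit_cone (Cofan.IsColimit.op (coproductIsCoproduct _))
        ((isLimitMapConeFanMkEquiv H _ _).symm hlim)
    have : PreservesLimit (Discrete.functor (K.obj ∘ Discrete.mk)) H := this
    exact preservesLimit_of_iso_diagram H (Discrete.natIsoFunctor (F := K)).symm

end IsBrownFunctor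

/-- Brown representability in terms of elements. -/
lemma BrownRepresentability.exists_universal [HasCoproducts.{v} C] (hC : BrownRepresentability C)
    {H : Cᵒᵖ ⥤ AddCommGrpCat.{v}} [H.PreservesZeroMorphisms] (hH : IsBrownFunctor H) :
    ∃ X : C, Nonempty (preadditiveYoneda.obj X ≅ H) :=
  hC H hH.isHomological hH.preservesLimitsOfShape

/-- A retract of an object exists as soon as the functor it would represent is
representable. -/
lemma BrownRepresentability.exists_splitting [HasCoproducts.{v} C] (hC : BrownRepresentability C)
    {R : C} (e : R ⟶ R) (he : e ≫ e = e) :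
    ∃ (X : C) (i : X ⟶ R) (p : R ⟶ X), i ≫ p = 𝟙 X ∧ p ≫ i = e := by
  -- The morphisms fixed by `e` form the functor that an image of `e` would represent.
  let H : Cᵒᵖ ⥤ AddCommGrpCat.{v} :=
    { obj := fun M => AddCommGrpCat.of
        ({ carrier := {x | x = x ≫ e}
           zero_mem' := zero_comp.symm
           add_mem' := fun {a b} ha hb => by
             change a + b = (a + b) ≫ e
             rw [Preadditive.add_comp, ← show a = a ≫ e from ha, ← show b = b ≫ e from hb]
           neg_mem' := fun {a} ha => by
             change -a = (-a) ≫ e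
             rw [Preadditive.neg_comp, ← show a = a ≫ e from ha] } : AddSubgroup (M.unop ⟶ R))
      map := fun f => AddCommGrpCat.ofHom
        { toFun := fun x => ⟨f.unop ≫ x.1, by
            have := x.2
            change x.1 = x.1 ≫ e at this
            change f.unop ≫ x.1 = (f.unop ≫ x.1) ≫ e
            rw [Category.assoc, ← this]⟩
          map_zero' := Subtype.ext comp_zero
          map_add' := fun x y => Subtype.ext (Preadditive.comp_add _ _ _ _ _ _) }
      map_id := fun M => by
        ext x
        exact Category.id_comp _
      map_comp := fun f g => by
        ext x
        exact Category.assoc _ _ _ }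
  have : H.PreservesZeroMorphisms := ⟨fun A B => by
    ext x
    change (0 : B.unop ⟶ A.unop) ≫ x.1 = (0 : B.unop ⟶ R)
    exact zero_comp⟩
  have hH : IsBrownFunctor H :=
    { exact := fun T hT x hx => by
        obtain ⟨y, hy⟩ := Triangle.yoneda_exact₂ T hT x.1 (congr_arg Subtype.val hx)
        refine ⟨⟨y ≫ e, ?_⟩, Subtype.ext ?_⟩
        · change y ≫ e = (y ≫ e) ≫ e
          rw [Category.assoc, he]
        · change T.mor₂ ≫ y ≫ e = x.1
          rw [← Category.assoc, ← hy]
          exact x.2.symm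
      existsUnique := fun J X c hc x => by
        refine ⟨⟨Cofan.IsColimit.desc hc fun j => (x j).1, ?_⟩, fun j => ?_, fun y hy => ?_⟩
        · refine Cofan.IsColimit.hom_ext hc _ _ fun j => ?_
          refine (Cofan.IsColimit.fac hc _ j).trans ((x j).2.trans ?_)
          rw [← Category.assoc]
          exact congr_arg (· ≫ e) (Cofan.IsColimit.fac hc (fun j => (x j).1) j).symm
        · exact Subtype.ext (Cofan.IsColimit.fac hc _ j)
        · refine Subtype.ext (Cofan.IsColimit.hom_ext hc _ _ fun j => ?_)
          rw [Cofan.IsColimit.fac]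
          exact congr_arg Subtype.val (hy j) }
  obtain ⟨X, hX⟩ := hC.exists_universal hH
  obtain ⟨η, hη⟩ := exists_universal_element hX
  have hη' : η.1 = η.1 ≫ e := η.2
  obtain ⟨p, hp, -⟩ := hη R ⟨e, he.symm⟩
  have hp' : p ≫ η.1 = e := congr_arg Subtype.val hp
  refine ⟨X, η.1, p, ?_, hp'⟩
  refine (hη X η).unique (Subtype.ext ?_) (Subtype.ext (Category.id_comp _))
  change (η.1 ≫ p) ≫ η.1 = η.1
  rw [Category.assoc, hp', ← hη']

/-- A product of representable functors is a Brown functor, and an object representing it is the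
product. -/
lemma BrownRepresentability.hasProducts [HasCoproducts.{v} C] (hC : BrownRepresentability C) :
    HasProducts.{v} C := by
  suffices ∀ {J : Type v} (X : J → C), ∃ c : Fan X, Nonempty (IsLimit c) from
    hasProducts_of_limit_fans (fun X => (this X).choose) (fun X => (this X).choose_spec.some)
  intro J Y
  let H : Cᵒᵖ ⥤ AddCommGrpCat.{v} :=
    { obj := fun M => AddCommGrpCat.of (∀ j, M.unop ⟶ Y j)
      map := fun f => AddCommGrpCat.ofHom
        { toFun := fun x j => f.unop ≫ x j
          map_zero' := funext fun j => comp_zero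
          map_add' := fun x y => funext fun j => Preadditive.comp_add _ _ _ _ _ _ }
      map_id := fun M => by
        ext x j
        exact Category.id_comp _
      map_comp := fun f g => by
        ext x j
        exact Category.assoc _ _ _ }
  have : H.PreservesZeroMorphisms := ⟨fun A B => by
    ext x j
    change (0 : B.unop ⟶ A.unop) ≫ x j = (0 : B.unop ⟶ Y j)
    exact zero_comp⟩
  have hH : IsBrownFunctor H :=
    { exact := fun T hT x hx => by
        choose y hy using fun j => Triangle.yoneda_exact₂ T hT (x j) (congr_fun hx j)
        exact ⟨y, funext fun j => (hy j).symm⟩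
      existsUnique := fun I X c hc x => by
        refine ⟨fun j => Cofan.IsColimit.desc hc fun i => x i j, fun i => ?_, fun y hy => ?_⟩
        · exact funext fun j => Cofan.IsColimit.fac hc _ i
        · refine funext fun j => Cofan.IsColimit.hom_ext hc _ _ fun i => ?_
          rw [Cofan.IsColimit.fac]
          exact congr_fun (hy i) j }
  obtain ⟨X, hX⟩ := hC.exists_universal hH
  obtain ⟨η, hη⟩ := exists_universal_element hX
  choose l hl hl' using hη
  exact ⟨Fan.mk X η, ⟨Fan.IsLimit.mk _ (fun s => l s.pt fun j => s.proj j)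
    (fun s j => congr_fun (hl s.pt _) j) (fun s m hm => hl' _ _ _ (funext hm))⟩⟩

/-- Injectivity of ℚ/ℤ keeps the dual of `C(P, -)` cohomological, and compactness of `P` makes it
turn coproducts into products. -/
lemma IsCompactObj.exists_dual [HasCoproducts.{v} C] (hC : BrownRepresentability C)
    {P : C} (hP : IsCompactObj P) : ∃ X, IsBrownComenetzDual P X := by
  refine hC _ ?_ ?_
  · have : (brownComenetzFunctor P).PreservesZeroMorphisms := by
      unfold brownComenetzFunctor; infer_instance
    refine ⟨fun T hT => ?_⟩
    rw [ShortComplex.ab_exact_iff]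
    intro x hx
    obtain ⟨ψ, hψ⟩ := exists_character_descent
      (Preadditive.rightComp P T.mor₂.unop) (Preadditive.rightComp P T.mor₁.unop)
      (fun b hb => by
        obtain ⟨a, ha⟩ := Triangle.coyoneda_exact₂ _ (unop_distinguished T hT) b hb
        exact ⟨a, ha.symm⟩)
      (homRatModIntEquiv ((preadditiveCoyoneda.obj (op P)).obj T.obj₂.unop) x)
      (congr_arg (homRatModIntEquiv ((preadditiveCoyoneda.obj (op P)).obj T.obj₃.unop)) hx)
    refine ⟨(homRatModIntEquiv ((preadditiveCoyoneda.obj (op P)).obj T.obj₁.unop)).symm ψ, ?_⟩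
    apply (homRatModIntEquiv ((preadditiveCoyoneda.obj (op P)).obj T.obj₂.unop)).injective
    exact hψ
  · intro J
    have := hP J
    have : PreservesColimitsOfShape (Discrete J)ᵒᵖ (preadditiveCoyoneda.obj (op P)) :=
      preservesColimitsOfShape_of_equiv (Discrete.opposite J).symm _
    have := preservesLimitsOfShape_op (Discrete J) (preadditiveCoyoneda.obj (op P))
    unfold brownComenetzFunctor
    infer_instance

end BrownFunctors
end CategoryTheory

namespace CategoryTheory

/-! ### Compact objects, coproducts and shifts -/

section Compact

variable {C : Type u} [Category.{v} C] [Preadditive C]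

open Classical in
/-- The projection of a coproduct to one of the summands. -/
noncomputable def cofanProj {J : Type v} {X : J → C} {c : Cofan X} (hc : IsColimit c) (j : J) :
    c.pt ⟶ X j :=
  Cofan.IsColimit.desc hc fun i => if h : i = j then eqToHom (congr_arg X h) else 0

lemma inj_cofanProj_self {J : Type v} {X : J → C} {c : Cofan X} (hc : IsColimit c) (j : J) :
    c.inj j ≫ cofanProj hc j = 𝟙 _ := by
  simp [cofanProj]

lemma inj_cofanProj_of_ne {J : Type v} {X : J → C} {c : Cofan X} (hc : IsColimit c) {i j : J}
    (h : i ≠ j) : c.inj i ≫ cofanProj hc j = 0 := by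
  simp [cofanProj, h]

/-- Morphisms from a compact object to a coproduct are generated by those that factor through
a summand. -/
lemma IsCompactObj.induction {P : C} (hP : IsCompactObj P) {J : Type v} {X : J → C} {c : Cofan X}
    (hc : IsColimit c) {p : (P ⟶ c.pt) → Prop} (zero : p 0)
    (add : ∀ a b, p a → p b → p (a + b)) (basic : ∀ j (a : P ⟶ X j), p (a ≫ c.inj j))
    (g : P ⟶ c.pt) : p g := by
  let S : AddSubgroup (P ⟶ c.pt) := AddSubgroup.closure {g | ∃ j a, g = a ≫ c.inj j}
  have hS : S = ⊤ := by
    have := hP J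
    have hlim := isColimitOfPreserves (preadditiveCoyoneda.obj (op P)) hc
    -- The quotient map by `S` vanishes on each summand, hence everywhere, because `C(P, -)`
    -- preserves the coproduct.
    have : AddCommGrpCat.ofHom (X := ((preadditiveCoyoneda.obj (op P)).obj c.pt))
        (QuotientAddGroup.mk' S) = 0 := hlim.hom_ext fun ⟨j⟩ => by
      ext a
      exact (QuotientAddGroup.eq_zero_iff (N := S) (a ≫ c.inj j)).2
        (AddSubgroup.subset_closure ⟨j, a, rfl⟩)
    rw [← QuotientAddGroup.ker_mk' S]
    ext g
    exact ⟨fun _ => trivial, fun _ => (ConcreteCategory.congr_hom this g :)⟩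
  have hg : g ∈ S := hS ▸ AddSubgroup.mem_top g
  have neg_basic : ∀ j (a : P ⟶ X j), p (-(a ≫ c.inj j)) := fun j a => by
    rw [← Preadditive.neg_comp]
    exact basic j _
  suffices p g ∧ p (-g) from this.1
  refine AddSubgroup.closure_induction (p := fun g _ => p g ∧ p (-g)) ?_ ?_ ?_ ?_ hg
  · rintro _ ⟨j, a, rfl⟩
    exact ⟨basic j a, neg_basic j a⟩
  · simpa using zero
  · rintro a b - - ha hb
    refine ⟨add _ _ ha.1 hb.1, ?_⟩
    rw [neg_add]
    exact add _ _ ha.2 hb.2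
  · rintro a - ha
    simpa using ha.symm

lemma IsCompactObj.eq_zero_of_proj {P : C} (hP : IsCompactObj P) {J : Type v} {X : J → C}
    {c : Cofan X} (hc : IsColimit c) (g : P ⟶ c.pt) (hg : ∀ j, g ≫ cofanProj hc j = 0) :
    g = 0 := by
  classical
  -- A map from a compact object is the finite sum of its components. Allowing every larger `t` lets
  -- two such expansions be added over a common index set.
  have : ∃ s : Finset J, ∀ t, s ⊆ t → g = ∑ j ∈ t, (g ≫ cofanProj hc j) ≫ c.inj j := by
    refine hP.induction hc (p := fun g => ∃ s : Finset J, ∀ t, s ⊆ t →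
      g = ∑ j ∈ t, (g ≫ cofanProj hc j) ≫ c.inj j) ⟨∅, by simp⟩ ?_ ?_ g
    · rintro a b ⟨s, hs⟩ ⟨t, ht⟩
      refine ⟨s ∪ t, fun r hr => ?_⟩
      simp only [Preadditive.add_comp, Finset.sum_add_distrib]
      rw [← hs r (Finset.union_subset_left hr), ← ht r (Finset.union_subset_right hr)]
    · intro i a
      refine ⟨{i}, fun t ht => ?_⟩
      rw [Finset.sum_eq_single i]
      · rw [Category.assoc a, inj_cofanProj_self, Category.comp_id]
      · intro j _ hj
        rw [Category.assoc a, inj_cofanProj_of_ne hc hj.symm, comp_zero, zero_comp]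
      · intro hi
        exact (hi (ht (Finset.mem_singleton_self i))).elim
  obtain ⟨s, hs⟩ := this
  rw [hs s subset_rfl]
  exact Finset.sum_eq_zero fun j _ => by rw [hg, zero_comp]

lemma forall_hom_iso_eq_zero_iff {A A' B B' : C} (e : A ≅ A') (e' : B ≅ B') :
    (∀ g : A ⟶ B, g = 0) ↔ ∀ g : A' ⟶ B', g = 0 := by
  constructor
  · intro H g
    rw [← cancel_epi e.hom, ← cancel_mono e'.inv, H ((e.hom ≫ g) ≫ e'.inv)]
    simp
  · intro H g
    rw [← cancel_epi e.inv, ← cancel_mono e'.hom, H ((e.inv ≫ g) ≫ e'.hom)]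
    simp

lemma IsCompactObj.of_iso {P Q : C} (hP : IsCompactObj P) (e : P ≅ Q) : IsCompactObj Q := by
  intro J
  have := hP J
  exact preservesColimitsOfShape_of_natIso (preadditiveCoyoneda.mapIso e.symm.op)

variable [HasShift C ℤ] [∀ n : ℤ, (shiftFunctor C n).Additive]

lemma forall_shift_hom_eq_zero_iff (A B : C) (n m : ℤ) (h : n + m = 0) :
    (∀ g : A⟦n⟧ ⟶ B, g = 0) ↔ ∀ g : A ⟶ B⟦m⟧, g = 0 := by
  obtain rfl : m = -n := by lia
  have : (shiftEquiv C n).functor.Additive := inferInstanceAs (shiftFunctor C n).Additive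
  let e : (A⟦n⟧ ⟶ B) ≃+ (A ⟶ B⟦-n⟧) := (shiftEquiv C n).toAdjunction.homAddEquiv A B
  constructor
  · intro H g
    rw [← e.apply_symm_apply g, H (e.symm g), map_zero]
  · intro H g
    rw [← e.symm_apply_apply g, H (e g), map_zero]

lemma IsCompactObj.shift {P : C} (hP : IsCompactObj P) (n : ℤ) : IsCompactObj (P⟦n⟧) := by
  intro J
  have := hP J
  have : (shiftEquiv C n).functor.Additive := inferInstanceAs (shiftFunctor C n).Additive
  let e : shiftFunctor C (-n) ⋙ preadditiveCoyoneda.obj (op P) ≅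
      preadditiveCoyoneda.obj (op (P⟦n⟧)) :=
    NatIso.ofComponents (fun M =>
      ((shiftEquiv C n).toAdjunction.homAddEquiv P M).symm.toAddCommGrpIso) (fun {M N} f => by
        ext g
        exact (shiftEquiv C n).toAdjunction.homEquiv_naturality_right_symm g f)
  exact preservesColimitsOfShape_of_natIso e

end Compact

end CategoryTheory

namespace CategoryTheory

variable {C : Type u} [Category.{v} C] [Preadditive C] [HasZeroObject C] [HasShift C ℤ]
  [∀ n : ℤ, (shiftFunctor C n).Additive] [Pretriangulated C]

/-! ### Exact sequences of triangles and homotopy colimits -/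

section Exactness

variable {X Y Z : C} {f : X ⟶ Y} {g : Y ⟶ Z} {h : Z ⟶ X⟦(1 : ℤ)⟧}
  (hT : Triangle.mk f g h ∈ distTriang C) {A : C}
include hT

lemma distTriang_comp₁₂ : f ≫ g = 0 := comp_distTriang_mor_zero₁₂ _ hT

lemma distTriang_comp₂₃ : g ≫ h = 0 := comp_distTriang_mor_zero₂₃ _ hT

lemma distTriang_comp₃₁ : h ≫ f⟦(1 : ℤ)⟧' = 0 := comp_distTriang_mor_zero₃₁ _ hT

lemma distTriang_exists_desc₂ (x : Y ⟶ A) (hx : f ≫ x = 0) : ∃ y : Z ⟶ A, g ≫ y = x :=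
  (Triangle.yoneda_exact₂ _ hT x hx).imp fun _ hy => hy.symm

lemma distTriang_exists_desc₃ (x : Z ⟶ A) (hx : g ≫ x = 0) : ∃ y : X⟦(1 : ℤ)⟧ ⟶ A, h ≫ y = x :=
  (Triangle.yoneda_exact₃ _ hT x hx).imp fun _ hy => hy.symm

lemma distTriang_exists_lift₁ (x : A ⟶ X⟦(1 : ℤ)⟧) (hx : x ≫ f⟦(1 : ℤ)⟧' = 0) :
    ∃ y : A ⟶ Z, y ≫ h = x :=
  (Triangle.coyoneda_exact₁ _ hT x hx).imp fun _ hy => hy.symm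

lemma distTriang_exists_lift₂ (x : A ⟶ Y) (hx : x ≫ g = 0) : ∃ y : A ⟶ X, y ≫ f = x :=
  (Triangle.coyoneda_exact₂ _ hT x hx).imp fun _ hy => hy.symm

lemma distTriang_exists_lift₃ (x : A ⟶ Z) (hx : x ≫ h = 0) : ∃ y : A ⟶ Y, y ≫ g = x :=
  (Triangle.coyoneda_exact₃ _ hT x hx).imp fun _ hy => hy.symm

/-- The obstruction to extending `x` along `f` lies in `C(Z, A⟦1⟧)`. -/
lemma distTriang_exists_extension (x : X ⟶ A) (hx : ∀ y : Z ⟶ A⟦(1 : ℤ)⟧, y = 0) :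
    ∃ y : Y ⟶ A, f ≫ y = x := by
  obtain ⟨y, hy⟩ : ∃ y : Y⟦(1 : ℤ)⟧ ⟶ A⟦(1 : ℤ)⟧, x⟦(1 : ℤ)⟧' = (-f⟦(1 : ℤ)⟧') ≫ y :=
    Triangle.yoneda_exact₃ _ (rot_of_distTriang _ hT) (x⟦(1 : ℤ)⟧') (hx _)
  obtain ⟨y, rfl⟩ := (shiftFunctor C (1 : ℤ)).map_surjective y
  refine ⟨-y, (shiftFunctor C (1 : ℤ)).map_injective (Eq.trans ?_ hy.symm)⟩
  rw [Functor.map_comp, Functor.map_neg, Preadditive.comp_neg, Preadditive.neg_comp]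

lemma IsBrownFunctor.exists_element {H : Cᵒᵖ ⥤ AddCommGrpCat.{v}} (hH : IsBrownFunctor H)
    (x : H.obj (op Y)) (hx : H.map f.op x = 0) : ∃ y : H.obj (op Z), H.map g.op y = x :=
  hH.exact _ hT x hx

end Exactness

/-- A homotopy colimit of a sequence `X 0 ⟶ X 1 ⟶ ⋯`: the cone of `1 - shift` on the
coproduct of the `X k`. -/
structure HomotopyColimit (X : ℕ → C) (f : ∀ k, X k ⟶ X (k + 1)) where
  coprod : C
  ι (k : ℕ) : X k ⟶ coprod
  isColimit : IsColimit (Cofan.mk (f := fun k : ULift.{v} ℕ => X k.down) coprod fun k => ι k.down)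
  next : coprod ⟶ coprod
  ι_next (k : ℕ) : ι k ≫ next = f k ≫ ι (k + 1)
  pt : C
  π : coprod ⟶ pt
  δ : pt ⟶ coprod⟦(1 : ℤ)⟧
  distinguished : Triangle.mk (𝟙 coprod - next) π δ ∈ distTriang C

lemma nonempty_homotopyColimit [HasCoproducts.{v} C] (X : ℕ → C) (f : ∀ k, X k ⟶ X (k + 1)) :
    Nonempty (HomotopyColimit X f) := by
  let Z : ULift.{v} ℕ → C := fun k => X k.down
  let s : ∐ Z ⟶ ∐ Z := Limits.Sigma.desc (f := Z) fun k => f k.down ≫ Sigma.ι Z ⟨k.down + 1⟩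
  obtain ⟨Y, p, δ, hT⟩ := distinguished_cocone_triangle (𝟙 (∐ Z) - s)
  exact ⟨{ coprod := ∐ Z
           ι := fun k => Sigma.ι Z ⟨k⟩
           isColimit := coproductIsCoproduct Z
           next := s
           ι_next := fun k => Limits.Sigma.ι_desc _ _
           pt := Y
           π := p
           δ := δ
           distinguished := hT }⟩

namespace HomotopyColimit

variable {X : ℕ → C} {f : ∀ k, X k ⟶ X (k + 1)} (Y : HomotopyColimit X f)

/-- The canonical morphism to the homotopy colimit. -/
def inj (k : ℕ) : X k ⟶ Y.pt := Y.ι k ≫ Y.π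

lemma coprod_hom_ext {A : C} {a b : Y.coprod ⟶ A} (h : ∀ k, Y.ι k ≫ a = Y.ι k ≫ b) : a = b :=
  Cofan.IsColimit.hom_ext Y.isColimit _ _ fun k => h k.down

lemma exists_coprod_desc {A : C} (a : ∀ k, X k ⟶ A) : ∃ b : Y.coprod ⟶ A, ∀ k, Y.ι k ≫ b = a k :=
  ⟨Cofan.IsColimit.desc Y.isColimit fun k => a k.down,
    fun k => Cofan.IsColimit.fac Y.isColimit (fun k => a k.down) ⟨k⟩⟩

lemma comp_inj (k : ℕ) : f k ≫ Y.inj (k + 1) = Y.inj k := by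
  have := distTriang_comp₁₂ Y.distinguished
  rw [Preadditive.sub_comp, Category.id_comp, sub_eq_zero] at this
  rw [inj, inj, ← Category.assoc, ← Y.ι_next, Category.assoc, ← this]

lemma exists_comp_inj {k n : ℕ} (h : k ≤ n) {P : C} (a : P ⟶ X k) :
    ∃ b : P ⟶ X n, b ≫ Y.inj n = a ≫ Y.inj k := by
  induction n, h using Nat.le_induction with
  | base => exact ⟨a, rfl⟩
  | succ n _ ih =>
    obtain ⟨b, hb⟩ := ih
    exact ⟨b ≫ f n, by rw [Category.assoc, Y.comp_inj, hb]⟩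

lemma ι_comp_one_sub {A : C} (a : Y.coprod ⟶ A) (k : ℕ) :
    Y.ι k ≫ (𝟙 _ - Y.next) ≫ a = Y.ι k ≫ a - f k ≫ Y.ι (k + 1) ≫ a := by
  rw [Preadditive.sub_comp, Preadditive.comp_sub, ← Category.assoc _ Y.next, Y.ι_next,
    Category.assoc, Category.id_comp]

/-- This is the surjectivity half of the Milnor sequence: a compatible family is an element over the
coproduct killed by `1 - shift`. -/
lemma exists_element {H : Cᵒᵖ ⥤ AddCommGrpCat.{v}} [H.Additive] (hH : IsBrownFunctor H)
    (η : ∀ k, H.obj (op (X k))) (hη : ∀ k, H.map (f k).op (η (k + 1)) = η k) :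
    ∃ y : H.obj (op Y.pt), ∀ k, H.map (Y.inj k).op y = η k := by
  have hcomp : ∀ {A B D : C} (a : A ⟶ B) (b : B ⟶ D) (x : H.obj (op D)),
      H.map a.op (H.map b.op x) = H.map (a ≫ b).op x := fun a b x => by
    rw [op_comp, H.map_comp]
    rfl
  obtain ⟨z, hz, -⟩ := hH.existsUnique _ _ _ Y.isColimit fun k => η k.down
  have hz' : ∀ k, H.map (Y.ι k).op z = η k := fun k => hz ⟨k⟩
  have h₀ : H.map (𝟙 Y.coprod - Y.next).op z = 0 := by
    refine (hH.existsUnique _ _ _ Y.isColimit fun _ => 0).unique (fun k => ?_)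
      fun k => map_zero _
    have h := Y.ι_comp_one_sub (𝟙 _) k.down
    rw [Category.comp_id, Category.comp_id, Category.comp_id] at h
    change H.map (Y.ι k.down).op _ = 0
    rw [hcomp, h, op_sub, H.map_sub]
    change H.map _ z - H.map _ z = 0
    rw [← hcomp, hz', hz', hη, sub_self]
  obtain ⟨y, hy⟩ := hH.exists_element Y.distinguished z h₀
  refine ⟨y, fun k => ?_⟩
  rw [inj, ← hcomp, ← hz' k, hy]

lemma exists_desc {A : C} (a : ∀ k, X k ⟶ A) (ha : ∀ k, f k ≫ a (k + 1) = a k) :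
    ∃ b : Y.pt ⟶ A, ∀ k, Y.inj k ≫ b = a k := by
  obtain ⟨c, hc⟩ := Y.exists_coprod_desc a
  obtain ⟨b, hb⟩ := distTriang_exists_desc₂ Y.distinguished c (Y.coprod_hom_ext fun k => by
    rw [ι_comp_one_sub, hc, hc, ha, sub_self, comp_zero])
  exact ⟨b, fun k => by rw [inj, Category.assoc, ← hc k, hb]⟩

/-- The obstruction is a `lim¹` of the groups `C(X k, A)`, which vanishes because the transition
maps are surjective. -/
lemma eq_zero_of_inj_comp {A : C} (hA : ∀ k (a : X k ⟶ A), ∃ b, f k ≫ b = a)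
    (φ : Y.pt ⟶ A⟦(1 : ℤ)⟧) (hφ : ∀ k, Y.inj k ≫ φ = 0) : φ = 0 := by
  obtain ⟨ψ, hψ⟩ := distTriang_exists_desc₃ Y.distinguished φ (Y.coprod_hom_ext fun k => by
    rw [comp_zero, ← Category.assoc]
    exact hφ k)
  obtain ⟨ψ, rfl⟩ := (shiftFunctor C (1 : ℤ)).map_surjective ψ
  -- Starting from 0, solve `θ k - f k ≫ θ (k + 1) = Y.ι k ≫ ψ` recursively; this exhibits `ψ` in
  -- the image of `1 - shift`.
  let θ : ∀ k, X k ⟶ A := fun k => Nat.rec (motive := fun k => X k ⟶ A) 0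
    (fun k t => (hA k (t - Y.ι k ≫ ψ)).choose) k
  have hθ : ∀ k, f k ≫ θ (k + 1) = θ k - Y.ι k ≫ ψ :=
    fun k => (hA k (θ k - Y.ι k ≫ ψ)).choose_spec
  obtain ⟨t, ht⟩ := Y.exists_coprod_desc θ
  have : (𝟙 _ - Y.next) ≫ t = ψ := Y.coprod_hom_ext fun k => by
    rw [ι_comp_one_sub, ht, ht, hθ, sub_sub_cancel]
  rw [← hψ, ← this, Functor.map_comp, ← Category.assoc, distTriang_comp₃₁ Y.distinguished,
    zero_comp]

lemma comp_next_proj (k : ℕ) :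
    Y.next ≫ cofanProj Y.isColimit ⟨k + 1⟩ = cofanProj Y.isColimit ⟨k⟩ ≫ f k := by
  refine Y.coprod_hom_ext fun i => ?_
  have h₁ : ∀ j, Y.ι j ≫ cofanProj Y.isColimit ⟨j⟩ = 𝟙 _ :=
    fun j => inj_cofanProj_self Y.isColimit ⟨j⟩
  have h₂ : ∀ i j, i ≠ j → Y.ι i ≫ cofanProj Y.isColimit ⟨j⟩ = 0 :=
    fun i j h => inj_cofanProj_of_ne Y.isColimit (i := ⟨i⟩) (j := ⟨j⟩) (by simpa using h)
  rw [← Category.assoc, Y.ι_next, Category.assoc, ← Category.assoc (Y.ι i)]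
  by_cases h : i = k
  · subst h
    rw [h₁, h₁, Category.id_comp, Category.comp_id]
  · rw [h₂ _ _ h, h₂ _ _ (by simpa using h), comp_zero, zero_comp]

lemma comp_next_proj_zero : Y.next ≫ cofanProj Y.isColimit ⟨0⟩ = 0 := by
  refine Y.coprod_hom_ext fun i => ?_
  rw [← Category.assoc, Y.ι_next, Category.assoc, comp_zero]
  have : Y.ι (i + 1) ≫ cofanProj Y.isColimit ⟨0⟩ = 0 :=
    inj_cofanProj_of_ne Y.isColimit (i := ⟨i + 1⟩) (j := ⟨0⟩) (by simp)
  rw [this, comp_zero]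

/-- On a compact object, `1 - shift` is injective. -/
lemma eq_zero_of_comp_next {P : C} (hP : IsCompactObj P) (g : P ⟶ Y.coprod)
    (hg : g ≫ Y.next = g) : g = 0 := by
  -- If `g` is fixed by the shift, its component at 0 vanishes, and each component determines the
  -- next.
  refine hP.eq_zero_of_proj Y.isColimit g ?_
  rintro ⟨k⟩
  induction k with
  | zero => rw [← hg, Category.assoc, comp_next_proj_zero, comp_zero]
  | succ k ih => rw [← hg, Category.assoc, comp_next_proj, ← Category.assoc, ih, zero_comp]

/-- The image of `δ` is the kernel of `1 - shift` one degree down, so its injectivity on `P⟦-1⟧`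
lets maps from `P` lift to the coproduct. -/
lemma comp_δ_eq_zero {P : C} (hP : ∀ g : P⟦(-1 : ℤ)⟧ ⟶ Y.coprod, g ≫ Y.next = g → g = 0)
    (g : P ⟶ Y.pt) : g ≫ Y.δ = 0 := by
  have h := distTriang_comp₃₁ Y.distinguished
  let e : P ≅ (P⟦(-1 : ℤ)⟧)⟦(1 : ℤ)⟧ := (shiftNegShift P (1 : ℤ)).symm
  obtain ⟨a, ha⟩ := (shiftFunctor C (1 : ℤ)).map_surjective (e.inv ≫ g ≫ Y.δ)
  have : a = 0 := hP a (by
    apply (shiftFunctor C (1 : ℤ)).map_injective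
    rw [Functor.map_sub, Functor.map_id, Preadditive.comp_sub, Category.comp_id, sub_eq_zero] at h
    rw [Functor.map_comp, ha, Category.assoc, Category.assoc, ← h])
  rw [← cancel_epi e.inv, ← ha, this, Functor.map_zero, comp_zero]

/-- Morphisms from a compact object to a homotopy colimit factor through one of the terms. -/
lemma exists_factorization {P : C} (hP : IsCompactObj P) (g : P ⟶ Y.pt) :
    ∃ (k : ℕ) (a : P ⟶ X k), a ≫ Y.inj k = g := by
  obtain ⟨b, hb⟩ := distTriang_exists_lift₃ Y.distinguished g
    (Y.comp_δ_eq_zero (fun g => Y.eq_zero_of_comp_next (hP.shift _) g) g)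
  rw [← hb]
  clear hb
  refine hP.induction Y.isColimit (p := fun b => ∃ (k : ℕ) (a : P ⟶ X k), a ≫ Y.inj k = b ≫ Y.π)
    ⟨0, 0, by rw [zero_comp, zero_comp]⟩ ?_ ?_ b
  · rintro b b' ⟨k, a, ha⟩ ⟨k', a', ha'⟩
    obtain ⟨c, hc⟩ := Y.exists_comp_inj (le_max_left k k') a
    obtain ⟨c', hc'⟩ := Y.exists_comp_inj (le_max_right k k') a'
    exact ⟨max k k', c + c', by
      rw [Preadditive.add_comp, hc, hc', ha, ha', ← Preadditive.add_comp]⟩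
  · rintro ⟨j⟩ a
    exact ⟨j, a, (Category.assoc _ _ _).symm⟩

/-- If the transition morphisms are null for a perfect class, then so is `shift`. -/
lemma comp_next_eq_zero {𝒮 : ObjectProperty C} (h𝒮 : 𝒮.IsPerfect) [HasCoproducts.{v} C]
    (hf : ∀ k, 𝒮.nullMorphisms (f k)) {P : C} (hP : 𝒮 P) (g : P ⟶ Y.coprod) :
    g ≫ Y.next = 0 := by
  let Z : ULift.{v} ℕ → C := fun k => X (k.down + 1)
  let φ : Y.coprod ⟶ ∐ Z :=
    Cofan.IsColimit.desc Y.isColimit fun k => f k.down ≫ Sigma.ι Z k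
  have hφ' : ∀ k, Y.ι k ≫ φ = f k ≫ Sigma.ι Z ⟨k⟩ := fun k =>
    Cofan.IsColimit.fac Y.isColimit (fun k => f k.down ≫ Sigma.ι Z k) ⟨k⟩
  have hφ : 𝒮.nullMorphisms φ :=
    (h𝒮.isStableUnderCoproductsOfShape (ULift.{v} ℕ)).condition _ _ _ _ Y.isColimit
      (coproductIsCoproduct Z) (Discrete.natTrans fun k => f k.as.down) (fun k => hf k.as.down) φ
      (fun k => hφ' k.as.down)
  have : Y.next = φ ≫ Limits.Sigma.desc (f := Z) fun k => Y.ι (k.down + 1) :=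
      Y.coprod_hom_ext fun k => by
    rw [Y.ι_next, ← Category.assoc, hφ', Category.assoc, Limits.Sigma.ι_desc]
  rw [this, ← Category.assoc, hφ hP, zero_comp]

/-- The shift vanishes on maps from `P` and from `P⟦-1⟧`, so `1 - shift` acts as the identity on
both. The object `P⟦-1⟧` enters because `δ` lands in `coprod⟦1⟧`. -/
lemma eq_zero_of_isPerfect {𝒮 : ObjectProperty C} (h𝒮 : 𝒮.IsPerfect) [HasCoproducts.{v} C]
    (hf : ∀ k, 𝒮.nullMorphisms (f k)) {P : C} (hP : 𝒮 P) (hP' : 𝒮 (P⟦(-1 : ℤ)⟧))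
    (g : P ⟶ Y.pt) : g = 0 := by
  obtain ⟨b, hb⟩ := distTriang_exists_lift₃ Y.distinguished g
    (Y.comp_δ_eq_zero (fun a ha => ha.symm.trans (Y.comp_next_eq_zero h𝒮 hf hP' a)) g)
  have h := distTriang_comp₁₂ Y.distinguished
  have h' : b ≫ (𝟙 _ - Y.next) = b := by
    rw [Preadditive.comp_sub, Category.comp_id, Y.comp_next_eq_zero h𝒮 hf hP, sub_zero]
  rw [← hb, ← h', Category.assoc, h, comp_zero]

end HomotopyColimit

end CategoryTheory

/-! ### The killing construction -/

namespace CategoryTheory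

variable {C : Type u} [Category.{v} C] [Preadditive C] [HasZeroObject C] [HasShift C ℤ]
  [∀ n : ℤ, (shiftFunctor C n).Additive] [Pretriangulated C]

/-- Morphisms `q` along which one can extend all morphisms to objects `A` right orthogonal to
the `G i`, and such that morphisms to `A⟦1⟧` are determined by their restriction. -/
structure IsOrthogonalExtension {ι : Type v} (G : ι → C) {M B : C} (q : M ⟶ B) : Prop where
  exists_extension : ∀ A : C, (∀ i (g : G i ⟶ A), g = 0) → ∀ a : M ⟶ A, ∃ b : B ⟶ A, q ≫ b = a
  eq_zero : ∀ A : C, (∀ i (g : G i ⟶ A), g = 0) → ∀ b : B ⟶ A⟦(1 : ℤ)⟧, q ≫ b = 0 → b = 0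

/-- In the long exact sequence of `C(-, Y)`, the fibre sits between a surjection and an injection.
-/
lemma IsOrthogonalExtension.fiber_eq_zero {ι : Type v} {G : ι → C} {A M B : C} {p : A ⟶ M}
    {q : M ⟶ B} {h : B ⟶ A⟦(1 : ℤ)⟧} (hq : IsOrthogonalExtension G q)
    (hT : Triangle.mk p q h ∈ distTriang C) {Y : C} (hY : ∀ i (g : G i ⟶ Y), g = 0)
    (a : A ⟶ Y) : a = 0 := by
  have h₁ : h ≫ a⟦(1 : ℤ)⟧' = 0 :=
    hq.eq_zero Y hY _ (by rw [← Category.assoc, distTriang_comp₂₃ hT, zero_comp])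
  obtain ⟨m, hm⟩ : ∃ m : M⟦(1 : ℤ)⟧ ⟶ Y⟦(1 : ℤ)⟧, (-p⟦(1 : ℤ)⟧') ≫ m = a⟦(1 : ℤ)⟧' :=
    distTriang_exists_desc₃ (rot_of_distTriang _ hT) _ h₁
  obtain ⟨m, rfl⟩ := (shiftFunctor C (1 : ℤ)).map_surjective m
  obtain ⟨b, rfl⟩ := hq.exists_extension Y hY m
  apply (shiftFunctor C (1 : ℤ)).map_injective
  rw [← hm, Preadditive.neg_comp, ← Functor.map_comp, ← Category.assoc, distTriang_comp₁₂ hT,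
    zero_comp, Functor.map_zero, neg_zero]

variable [HasCoproducts.{v} C] {ι : Type v} (G : ι → C)
  {H : Cᵒᵖ ⥤ AddCommGrpCat.{v}} (hH : IsBrownFunctor H)
include hH

lemma IsBrownFunctor.exists_killing_step (M : C) (η : H.obj (op M)) :
    ∃ (B : C) (q : M ⟶ B) (θ : H.obj (op B)), H.map q.op θ = η ∧ IsOrthogonalExtension G q ∧
      ∀ i (g : G i ⟶ M), H.map g.op η = 0 → g ≫ q = 0 := by
  -- One cell for each map to be killed; since `η` restricts to 0 on the cells, it extends to the
  -- cone.
  let K := Σ i, {g : G i ⟶ M // H.map g.op η = 0}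
  let Z : K → C := fun k => G k.1
  let d : ∐ Z ⟶ M := Limits.Sigma.desc (f := Z) fun k => k.2.1
  have hd : ∀ k, Limits.Sigma.ι Z k ≫ d = k.2.1 := fun k => Limits.Sigma.ι_desc _ _
  obtain ⟨B, q, h, hT⟩ := distinguished_cocone_triangle d
  have hdη : H.map d.op η = 0 := by
    refine (hH.existsUnique K Z _ (coproductIsCoproduct Z) fun _ => 0).unique (fun k => ?_)
      fun k => map_zero _
    have : H.map (Limits.Sigma.ι Z k ≫ d).op η = 0 := by
      rw [hd]
      exact k.2.2
    rw [op_comp, H.map_comp] at this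
    exact this
  obtain ⟨θ, hθ⟩ := hH.exists_element hT η hdη
  refine ⟨B, q, θ, hθ, ⟨fun A hA a => ?_, fun A hA b hb => ?_⟩, fun i g hg => ?_⟩
  · exact distTriang_exists_desc₂ hT a (Sigma.hom_ext _ _ fun k => hA _ _ |>.trans (hA _ _).symm)
  · obtain ⟨c, rfl⟩ := distTriang_exists_desc₃ hT b hb
    obtain ⟨c, rfl⟩ := (shiftFunctor C (1 : ℤ)).map_surjective c
    have : c = 0 := Sigma.hom_ext _ _ fun k => hA _ _ |>.trans (hA _ _).symm
    rw [this, Functor.map_zero, comp_zero]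
  · have := hd ⟨i, g, hg⟩
    dsimp only at this
    rw [← this, Category.assoc, distTriang_comp₁₂ hT, comp_zero]

/-- One can kill, in a homotopy colimit of a sequence of cones, all morphisms from the `G i`
that are annihilated by an element of a Brown functor. -/
theorem IsBrownFunctor.exists_killing [H.Additive] (M : C) (η : H.obj (op M)) :
    ∃ (B : C) (q : M ⟶ B) (θ : H.obj (op B)), H.map q.op θ = η ∧ IsOrthogonalExtension G q ∧
      (∀ i, IsCompactObj (G i) → ∀ g : G i ⟶ B, H.map g.op θ = 0 → g = 0) ∧
      ((∀ i (x : H.obj (op (G i))), x = 0) → ∀ 𝒮 : ObjectProperty C, 𝒮.IsPerfect →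
        (∀ P, 𝒮 P → ∃ i, Nonempty (P ≅ G i)) → ∀ P, 𝒮 P → 𝒮 (P⟦(-1 : ℤ)⟧) →
        ∀ g : P ⟶ B, g = 0) := by
  choose B q θ hθ hq hg using hH.exists_killing_step G
  let s : ℕ → Σ X : C, H.obj (op X) := fun k => Nat.rec ⟨M, η⟩ (fun _ t => ⟨B t.1 t.2, θ t.1 t.2⟩) k
  let X : ℕ → C := fun k => (s k).1
  let e : ∀ k, H.obj (op (X k)) := fun k => (s k).2
  let f : ∀ k, X k ⟶ X (k + 1) := fun k => q (X k) (e k)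
  have he : ∀ k, H.map (f k).op (e (k + 1)) = e k := fun k => hθ (X k) (e k)
  obtain ⟨Y⟩ := nonempty_homotopyColimit X f
  obtain ⟨y, hy⟩ := Y.exists_element hH e he
  refine ⟨Y.pt, Y.inj 0, y, hy 0, ⟨fun A hA a => ?_, fun A hA b hb => ?_⟩, fun i hi g hgy => ?_,
    fun hG 𝒮 h𝒮 h𝒮G P hP hP' g => ?_⟩
  · let b : ∀ k, X k ⟶ A := fun k => Nat.rec (motive := fun k => X k ⟶ A) a
      (fun k t => ((hq (X k) (e k)).exists_extension A hA t).choose) k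
    have hb : ∀ k, f k ≫ b (k + 1) = b k :=
      fun k => ((hq (X k) (e k)).exists_extension A hA (b k)).choose_spec
    obtain ⟨c, hc⟩ := Y.exists_desc b hb
    exact ⟨c, hc 0⟩
  · refine Y.eq_zero_of_inj_comp (fun k a => (hq (X k) (e k)).exists_extension A hA a) b
      fun k => ?_
    induction k with
    | zero => exact hb
    | succ k ih =>
      rw [← Y.comp_inj k, Category.assoc] at ih
      exact (hq (X k) (e k)).eq_zero A hA _ ih
  -- By compactness `g` already lives at a stage `k`, and it is coned off at stage `k + 1`.
  · obtain ⟨k, a, rfl⟩ := Y.exists_factorization hi g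
    have h₁ : H.map a.op (e k) = 0 := by
      rw [← hy k, ← hgy, op_comp, H.map_comp]
      rfl
    rw [← Y.comp_inj, ← Category.assoc, show a ≫ f k = 0 from hg _ _ i a h₁, zero_comp]
  -- When `H` vanishes on the generators, each step kills all maps from them, so the transition
  -- morphisms are null.
  · refine Y.eq_zero_of_isPerfect h𝒮 (fun k Q hQ a => ?_) hP hP' g
    obtain ⟨i, ⟨φ⟩⟩ := h𝒮G Q hQ
    rw [← cancel_epi φ.inv, comp_zero, ← Category.assoc]
    exact hg _ _ i _ (hG i _)

end CategoryTheory

namespace CategoryTheory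

/-! ### Brown representability for compactly generated categories -/

section BrownRepresentability

variable {C : Type u} [Category.{v} C] [Preadditive C]

lemma nonempty_preadditiveYoneda_iso {H : Cᵒᵖ ⥤ AddCommGrpCat.{v}} [H.Additive] {X : C}
    (θ : H.obj (op X)) (hθ : ∀ (M : C) (y : H.obj (op M)), ∃! f : M ⟶ X, H.map f.op θ = y) :
    Nonempty (preadditiveYoneda.obj X ≅ H) := by
  let e : ∀ M : C, (M ⟶ X) ≃+ H.obj (op M) := fun M =>
    AddEquiv.ofBijective (AddMonoidHom.mk' (fun f : M ⟶ X => H.map f.op θ) fun a b => by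
      rw [op_add, H.map_add]
      rfl) ⟨fun a b hab => (hθ M (H.map b.op θ)).unique hab rfl, fun y => (hθ M y).exists⟩
  exact ⟨NatIso.ofComponents (fun M => (e M.unop).toAddCommGrpIso) fun {M N} f => by
    ext x
    change H.map (f.unop ≫ x).op θ = H.map f (H.map x.op θ)
    exact ConcreteCategory.congr_hom
      (H.map_comp (Quiver.Hom.op (x : M.unop ⟶ X)) f) θ⟩

variable [HasZeroObject C] [HasShift C ℤ]
  [∀ n : ℤ, (shiftFunctor C n).Additive] [Pretriangulated C]

/-- The cone receives no maps from the generators. Closure under `⟦-1⟧` turns injectivity on the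
generators into vanishing of the connecting map. -/
lemma isIso_of_generators {ι : Type v} {G : ι → C}
    (hG : ∀ i, ∃ j, Nonempty (G j ≅ (G i)⟦(-1 : ℤ)⟧))
    (hG₀ : ∀ X : C, (∀ i (g : G i ⟶ X), g = 0) → IsZero X) {X X' : C} (f : X ⟶ X')
    (hf : ∀ i (g : G i ⟶ X), g ≫ f = 0 → g = 0)
    (hf' : ∀ i (g' : G i ⟶ X'), ∃ g : G i ⟶ X, g ≫ f = g') : IsIso f := by
  obtain ⟨Z, p, h, hT⟩ := distinguished_cocone_triangle f
  refine (Triangle.isZero₃_iff_isIso₁ _ hT).1 (hG₀ Z fun i g => ?_)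
  have hg : g ≫ h = 0 := by
    obtain ⟨j, ⟨φ⟩⟩ := hG i
    let e : (G i) ≅ (G j)⟦(1 : ℤ)⟧ :=
      (shiftNegShift (G i) (1 : ℤ)).symm ≪≫ (shiftFunctor C (1 : ℤ)).mapIso φ.symm
    obtain ⟨a, ha⟩ := (shiftFunctor C (1 : ℤ)).map_surjective (e.inv ≫ g ≫ h)
    have : a = 0 := hf j a ((shiftFunctor C (1 : ℤ)).map_injective (by
      rw [Functor.map_comp, ha, Category.assoc, Category.assoc, distTriang_comp₃₁ hT, comp_zero,
        comp_zero, Functor.map_zero]))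
    rw [← cancel_epi e.inv, ← ha, this, Functor.map_zero, comp_zero]
  obtain ⟨g', rfl⟩ := distTriang_exists_lift₃ hT g hg
  obtain ⟨g, rfl⟩ := hf' i g'
  rw [Category.assoc, distTriang_comp₁₂ hT, comp_zero]

variable [HasCoproducts.{v} C] {ι : Type v} {G : ι → C}

lemma IsBrownFunctor.exists_approximation {H : Cᵒᵖ ⥤ AddCommGrpCat.{v}} [H.Additive]
    (hH : IsBrownFunctor H) (hG : ∀ i, IsCompactObj (G i)) (M : C) (η : H.obj (op M)) :
    ∃ (X : C) (q : M ⟶ X) (θ : H.obj (op X)), H.map q.op θ = η ∧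
      (∀ i (g : G i ⟶ X), H.map g.op θ = 0 → g = 0) ∧
      ∀ i (x : H.obj (op (G i))), ∃ g : G i ⟶ X, H.map g.op θ = x := by
  -- `none` carries `M` with `η`; one extra summand per element of each `H (G i)` forces
  -- surjectivity before killing forces injectivity.
  let K := Option (Σ i, H.obj (op (G i)))
  let Z : K → C := fun k => Option.rec M (fun k => G k.1) k
  let z : ∀ k, H.obj (op (Z k)) := fun k => match k with
    | none => η
    | some k => k.2
  obtain ⟨η', hη', -⟩ := hH.existsUnique K Z _ (coproductIsCoproduct Z) z
  obtain ⟨X, q, θ, hθ, -, hX, -⟩ := hH.exists_killing G (∐ Z) η'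
  refine ⟨X, Limits.Sigma.ι Z none ≫ q, θ, ?_, fun i => hX i (hG i), fun i x =>
    ⟨Limits.Sigma.ι Z (some ⟨i, x⟩) ≫ q, ?_⟩⟩
  · rw [op_comp, H.map_comp]
    exact (congr_arg _ hθ).trans (hη' none)
  · rw [op_comp, H.map_comp]
    exact (congr_arg _ hθ).trans (hη' (some ⟨i, x⟩))

/-- Neeman's Brown representability theorem. -/
theorem brownRepresentability_of_isCompactObj (hG : ∀ i, IsCompactObj (G i))
    (hG' : ∀ i, ∃ j, Nonempty (G j ≅ (G i)⟦(-1 : ℤ)⟧))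
    (hG₀ : ∀ X : C, (∀ i (g : G i ⟶ X), g = 0) → IsZero X) : BrownRepresentability C := by
  intro H _ _
  have hH := isBrownFunctor_of_preserves H
  have hcomp : ∀ {A B D : C} (a : A ⟶ B) (b : B ⟶ D) (x : H.obj (op D)),
      H.map (a ≫ b).op x = H.map a.op (H.map b.op x) := fun a b x => by
    rw [op_comp, H.map_comp]
    rfl
  have hsub : ∀ {A B : C} (a b : A ⟶ B) (x : H.obj (op B)),
      H.map (a - b).op x = H.map a.op x - H.map b.op x := fun a b x => by
    rw [op_sub, H.map_sub]
    rfl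
  have hiso : ∀ {X X' : C} (f : X ⟶ X') (θ : H.obj (op X)) (θ' : H.obj (op X')),
      H.map f.op θ' = θ → (∀ i (g : G i ⟶ X), H.map g.op θ = 0 → g = 0) →
      (∀ i (x : H.obj (op (G i))), ∃ g : G i ⟶ X, H.map g.op θ = x) →
      (∀ i (g : G i ⟶ X'), H.map g.op θ' = 0 → g = 0) → IsIso f := by
    rintro X X' f _ θ' rfl h₁ h₂ h₃
    refine isIso_of_generators hG' hG₀ f (fun i g hg => h₁ i g ?_) fun i g' => ?_
    · rw [← hcomp, hg, op_zero, H.map_zero]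
      rfl
    · obtain ⟨g, hg⟩ := h₂ i (H.map g'.op θ')
      refine ⟨g, sub_eq_zero.1 (h₃ i _ ?_)⟩
      rw [hsub, hcomp, hg, sub_self]
  obtain ⟨X₀, -⟩ := HasZeroObject.zero (C := C)
  obtain ⟨X, -, θ, -, hX, hX'⟩ := hH.exists_approximation hG X₀ 0
  refine ⟨X, nonempty_preadditiveYoneda_iso θ fun N y => existsUnique_of_exists_of_unique ?_ ?_⟩
  -- Approximate `X ⊞ N` with the element that is `θ` on `X` and `y` on `N`. Then `X ⟶ X'` is an
  -- isomorphism, through which `N ⟶ X'` is pulled back.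
  · obtain ⟨X', q, θ', hq, h₁, -⟩ := hH.exists_approximation hG (X ⊞ N)
      (H.map biprod.fst.op θ + H.map biprod.snd.op y)
    have hz : ∀ {A B : C} (x : H.obj (op B)), H.map (0 : A ⟶ B).op x = 0 := fun x => by
      rw [op_zero, H.map_zero]
      rfl
    have hid : ∀ {A : C} (x : H.obj (op A)), H.map (𝟙 A).op x = x := fun x => by
      rw [op_id, H.map_id]
      rfl
    have hl : H.map (biprod.inl ≫ q).op θ' = θ := by
      rw [hcomp, hq, map_add, ← hcomp, ← hcomp, biprod.inl_fst, biprod.inl_snd, hz, hid, add_zero]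
    have hr : H.map (biprod.inr ≫ q).op θ' = y := by
      rw [hcomp, hq, map_add, ← hcomp, ← hcomp, biprod.inr_fst, biprod.inr_snd, hz, hid, zero_add]
    have := hiso (biprod.inl ≫ q) θ θ' hl hX hX' h₁
    refine ⟨(biprod.inr ≫ q) ≫ inv (biprod.inl ≫ q), ?_⟩
    rw [← hr, hcomp, ← hl, ← hcomp (inv _), IsIso.inv_hom_id, hid]
  · intro f f' hf hf'
    -- `θ` extends over the cone of `f - f'`; after approximating the cone, `X ⟶ X'` is an
    -- isomorphism annihilating `f - f'`.
    obtain ⟨Y, c, h, hT⟩ := distinguished_cocone_triangle (f - f')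
    obtain ⟨z, hz⟩ := hH.exists_element hT θ (by rw [hsub, hf, hf', sub_self])
    obtain ⟨X', q, θ', hq, h₁, -⟩ := hH.exists_approximation hG Y z
    have := hiso (c ≫ q) θ θ' (by rw [hcomp, hq, hz]) hX hX' h₁
    rw [← sub_eq_zero, ← cancel_mono (c ≫ q), zero_comp, ← Category.assoc, distTriang_comp₁₂ hT,
      zero_comp]

end BrownRepresentability

end CategoryTheory

/-! ### Generating weight structures by perfect classes -/

namespace CategoryTheory

section

variable {C : Type u} [Category.{v} C]

lemma ObjectProperty.EssentiallySmall.exists_family (𝒮 : ObjectProperty C)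
    [ObjectProperty.EssentiallySmall.{v} 𝒮] :
    ∃ (ι : Type v) (G : ι → C), (∀ i, 𝒮 (G i)) ∧ ∀ P, 𝒮 P → ∃ i, Nonempty (P ≅ G i) := by
  obtain ⟨𝒬, h𝒬, h₁, h₂⟩ := ObjectProperty.EssentiallySmall.exists_small_le.{v} 𝒮
  refine ⟨Shrink.{v} (Subtype 𝒬), fun i => ((equivShrink _).symm i).1,
    fun i => h₁ _ ((equivShrink _).symm i).2, fun P hP => ?_⟩
  obtain ⟨Q, hQ, ⟨e⟩⟩ := h₂ P hP
  exact ⟨equivShrink _ ⟨Q, hQ⟩, ⟨e ≪≫ eqToIso (by simp)⟩⟩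

variable [HasShift C ℤ]

lemma ObjectProperty.essentiallySmall_of_shifts (𝒮 : ObjectProperty C)
    [ObjectProperty.EssentiallySmall.{v} 𝒮] (𝒬 : ObjectProperty C)
    (h : ∀ X, 𝒬 X → ∃ (i : ℤ) (P : C), 𝒮 P ∧ Nonempty (X ≅ P⟦i⟧)) :
    ObjectProperty.EssentiallySmall.{v} 𝒬 := by
  obtain ⟨ι, G, -, hG⟩ := ObjectProperty.EssentiallySmall.exists_family 𝒮
  refine ⟨ObjectProperty.ofObj fun x : ℤ × ι => (G x.2)⟦x.1⟧, inferInstance, fun X hX => ?_⟩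
  obtain ⟨i, P, hP, ⟨e⟩⟩ := h X hX
  obtain ⟨j, ⟨e'⟩⟩ := hG P hP
  exact ⟨_, ObjectProperty.ofObj_apply _ (i, j), ⟨e ≪≫ (shiftFunctor C i).mapIso e'⟩⟩

end

variable {C : Type u} [Category.{v} C] [Preadditive C] [HasZeroObject C] [HasShift C ℤ]
  [∀ n : ℤ, (shiftFunctor C n).Additive] [Pretriangulated C]

/-- A distinguished triangle around `M⟦n⟧` can be shifted to one around `M`. -/
lemma exists_shifted_triangle {A M B : C} (n m : ℤ) (hnm : n + m = 0) {p : A ⟶ M⟦n⟧}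
    {q : M⟦n⟧ ⟶ B} {h : B ⟶ A⟦(1 : ℤ)⟧} (hT : Triangle.mk p q h ∈ distTriang C) :
    ∃ (p' : A⟦m⟧ ⟶ M) (q' : M ⟶ B⟦m⟧) (h' : B⟦m⟧ ⟶ A⟦m⟧⟦(1 : ℤ)⟧),
      Triangle.mk p' q' h' ∈ distTriang C := by
  obtain rfl : m = -n := by lia
  let T := (Triangle.shiftFunctor C (-n)).obj (Triangle.mk p q h)
  let e : T.obj₂ ≅ M := (shiftEquiv C n).unitIso.symm.app M
  have h₁ : (T.mor₁ ≫ e.hom) ≫ e.inv = 𝟙 _ ≫ T.mor₁ := by simp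
  have h₂ : (e.inv ≫ T.mor₂) ≫ 𝟙 _ = e.inv ≫ T.mor₂ := by simp
  have h₃ : T.mor₃ ≫ (𝟙 T.obj₁)⟦(1 : ℤ)⟧' = 𝟙 _ ≫ T.mor₃ := by simp
  exact ⟨T.mor₁ ≫ e.hom, e.inv ≫ T.mor₂, T.mor₃,
    isomorphic_distinguished _ (Triangle.shift_distinguished _ hT (-n)) _
      (Triangle.isoMk _ _ (Iso.refl _) e.symm (Iso.refl _) h₁ h₂ h₃)⟩

variable [HasCoproducts.{v} C]

/-- The truncation triangles with respect to an essentially small class of objects. -/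
theorem exists_truncation_triangle (𝒮 : ObjectProperty C)
    [ObjectProperty.EssentiallySmall.{v} 𝒮]
    (h𝒮 : (∀ P, 𝒮 P → IsCompactObj P) ∨ (𝒮.IsPerfect ∧ ∀ P, 𝒮 P → 𝒮 (P⟦(-1 : ℤ)⟧))) (M : C) :
    ∃ (A B : C) (p : A ⟶ M) (q : M ⟶ B) (h : B ⟶ A⟦(1 : ℤ)⟧),
      Triangle.mk p q h ∈ distTriang C ∧ 𝒮.rightOrthogonal.leftOrthogonal A ∧
        𝒮.rightOrthogonal B := by
  obtain ⟨ι, G, hG, hG'⟩ := ObjectProperty.EssentiallySmall.exists_family 𝒮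
  -- For the zero functor, every map from a generator is among those to be killed.
  let H : Cᵒᵖ ⥤ AddCommGrpCat.{v} := (Functor.const _).obj (AddCommGrpCat.of PUnit)
  have hH : IsBrownFunctor H :=
    ⟨fun _ _ _ _ => ⟨PUnit.unit, rfl⟩, fun _ _ _ _ _ => ⟨PUnit.unit, fun _ => rfl, fun _ _ => rfl⟩⟩
  have : H.Additive := ⟨fun {_ _ _ _} => by ext; rfl⟩
  obtain ⟨B, q, θ, -, hq, h₁, h₂⟩ := hH.exists_killing G M PUnit.unit
  obtain ⟨A, p, h, hT⟩ := distinguished_cocone_triangle₁ q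
  refine ⟨A, B, p, q, h, hT, fun Y a hY => hq.fiber_eq_zero hT (fun i g => hY g (hG i)) a, ?_⟩
  rcases h𝒮 with h𝒮 | ⟨h𝒮, h𝒮'⟩
  · intro P g hP
    obtain ⟨i, ⟨e⟩⟩ := hG' P hP
    rw [← cancel_epi e.inv, comp_zero]
    exact h₁ i (h𝒮 _ (hG i)) _ rfl
  · exact fun P g hP => h₂ (fun _ _ => rfl) 𝒮 h𝒮 hG' P hP (h𝒮' P hP) g

/-- An essentially small perfect class generates a weight structure. -/
theorem exists_weightStructure_isGeneratedBy (𝒮 : ObjectProperty C)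
    [ObjectProperty.EssentiallySmall.{v} 𝒮] (h𝒮 : 𝒮.negativeShifts.IsPerfect) :
    ∃ w : WeightStructure C, w.IsGeneratedBy 𝒮 := by
  have : ObjectProperty.EssentiallySmall.{v} 𝒮.negativeShifts :=
    𝒮.essentiallySmall_of_shifts _ fun X ⟨i, _, P, hP, e⟩ => ⟨-i, P, hP, e⟩
  have hneg : ∀ P, 𝒮.negativeShifts P → 𝒮.negativeShifts (P⟦(-1 : ℤ)⟧) := by
    rintro P ⟨i, hi, Q, hQ, ⟨e⟩⟩
    exact ⟨i + 1, by lia, Q, hQ, ⟨(shiftFunctor C (-1 : ℤ)).mapIso e ≪≫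
      ((shiftFunctorAdd' C (-i) (-1) (-(i + 1)) (by lia)).app Q).symm⟩⟩
  have hge : ∀ X, 𝒮.negativeShifts.rightOrthogonal X →
      𝒮.negativeShifts.rightOrthogonal (X⟦(1 : ℤ)⟧) := fun X hX P f hP =>
    (forall_shift_hom_eq_zero_iff P X (-1) 1 rfl).1 (fun g => hX g (hneg P hP)) f
  refine ⟨
    { le := fun X => ∀ Y, 𝒮.negativeShifts.rightOrthogonal Y → ∀ f : X ⟶ Y⟦(1 : ℤ)⟧, f = 0
      ge := 𝒮.negativeShifts.rightOrthogonal
      le_retract := ⟨fun {X Y} r hY Z hZ f => ?_⟩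
      ge_retract := ⟨fun {X Y} r hY Z f hZ => ?_⟩
      le_shift := fun X hX Y hY =>
        (forall_shift_hom_eq_zero_iff _ _ (-1) 1 rfl).2 (hX _ (hge Y hY))
      ge_shift := hge
      orthogonal := fun X Y hX hY f => hX Y hY f
      exists_decomposition := fun M => ?_ }, rfl⟩
  · have h := hY Z hZ (r.r ≫ f)
    rw [← Category.id_comp f, ← r.retract, Category.assoc, h, comp_zero]
  · have h := hY (f ≫ r.i) hZ
    rw [← Category.comp_id f, ← r.retract, ← Category.assoc, h, zero_comp]
  -- Truncating `M⟦-1⟧` and shifting back gives the right-hand term the form `B⟦1⟧` of a weight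
  -- decomposition.
  · obtain ⟨A, B, p, q, h, hT, hA, hB⟩ :=
      exists_truncation_triangle 𝒮.negativeShifts (Or.inr ⟨h𝒮, hneg⟩)
      (M⟦(-1 : ℤ)⟧)
    obtain ⟨p', q', h', hT'⟩ := exists_shifted_triangle (-1) 1 rfl hT
    refine ⟨A⟦(1 : ℤ)⟧, B, fun Y hY f => ?_, hB, p', q', h', hT'⟩
    obtain ⟨f, rfl⟩ := (shiftFunctor C (1 : ℤ)).map_surjective f
    rw [hA f hY, Functor.map_zero]

end CategoryTheory

/-! ### Generating t-structures by compact objects -/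

namespace CategoryTheory

variable {C : Type u} [Category.{v} C] [Preadditive C] [HasZeroObject C] [HasShift C ℤ]
  [∀ n : ℤ, (shiftFunctor C n).Additive] [Pretriangulated C] [HasCoproducts.{v} C]

/-- An essentially small class of compact objects generates a t-structure. -/
theorem exists_tStructure_isGeneratedBy (𝒮 : ObjectProperty C)
    [ObjectProperty.EssentiallySmall.{v} 𝒮] (h𝒮 : ∀ P, 𝒮 P → IsCompactObj P) :
    ∃ t : TStructure C, t.IsGeneratedBy 𝒮 := by
  have : ObjectProperty.EssentiallySmall.{v} 𝒮.positiveShifts :=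
    𝒮.essentiallySmall_of_shifts _ fun X ⟨i, _, P, hP, e⟩ => ⟨i, P, hP, e⟩
  have hcomp : ∀ P, 𝒮.positiveShifts P → IsCompactObj P := fun P ⟨i, _, Q, hQ, ⟨e⟩⟩ =>
    ((h𝒮 Q hQ).shift i).of_iso e.symm
  set D := 𝒮.positiveShifts.rightOrthogonal with hD
  have hshift (X : C) (a b c : ℤ) (h : a + b = c) : D (X⟦a⟧⟦b⟧) ↔ D (X⟦c⟧) :=
    D.prop_iff_of_iso ((shiftFunctorAdd' C a b c h).symm.app X)
  have hneg (X : C) (hX : D X) : D (X⟦(-1 : ℤ)⟧) := by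
    rintro P f ⟨i, hi, Q, hQ, ⟨e⟩⟩
    refine (forall_shift_hom_eq_zero_iff P X 1 (-1) rfl).1 (fun g => hX g ?_) f
    exact ⟨i + 1, by lia, Q, hQ, ⟨(shiftFunctor C (1 : ℤ)).mapIso e ≪≫
      ((shiftFunctorAdd' C i 1 (i + 1) rfl).app Q).symm⟩⟩
  have hmono (X : C) (n m : ℤ) (h : m + 1 = n) (hX : D (X⟦n⟧)) : D (X⟦m⟧) :=
    (hshift X n (-1) m (by lia)).1 (hneg _ hX)
  refine ⟨
    { le := fun n X => ∀ Y : C, D (Y⟦n + 1⟧) → ∀ f : X ⟶ Y, f = 0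
      ge := fun n X => D (X⟦n⟧)
      le_isClosedUnderIsomorphisms := fun n => ⟨fun {X X'} e hX Y hY f => ?_⟩
      ge_isClosedUnderIsomorphisms := fun n => ⟨fun {X X'} e hX =>
        D.prop_of_iso ((shiftFunctor C n).mapIso e) hX⟩
      le_shift := fun n a n' h X hX Y hY =>
        (forall_shift_hom_eq_zero_iff X Y a (-a) (by lia)).2
          (hX _ ((hshift Y (-a) (n + 1) (n' + 1) (by lia)).2 hY))
      ge_shift := fun n a n' h X hX => (hshift X a n' n h).2 hX
      zero' := fun X Y f hX hY => hX Y hY f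
      le_zero_le := fun X hX Y hY => hX Y (hmono _ _ _ (by lia) hY)
      ge_one_le := fun X hX => hmono _ _ _ (by lia) hX
      exists_triangle_zero_one := fun M => ?_ }, ?_⟩
  · have := hX Y hY (e.hom ≫ f)
    rwa [← cancel_epi e.hom, comp_zero]
  -- `D` is the class `ge 0`, whereas the triangle needs its third term in `ge 1`; hence truncate
  -- `M⟦1⟧` and shift back.
  · obtain ⟨A, B, p, q, h, hT, hA, hB⟩ := exists_truncation_triangle 𝒮.positiveShifts
      (Or.inl hcomp) (M⟦(1 : ℤ)⟧)
    obtain ⟨p', q', h', hT'⟩ := exists_shifted_triangle 1 (-1) rfl hT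
    refine ⟨A⟦(-1 : ℤ)⟧, B⟦(-1 : ℤ)⟧, fun Y hY => ?_, ?_, p', q', h', hT'⟩
    · exact (forall_shift_hom_eq_zero_iff A Y (-1) 1 rfl).2 fun g => hA g hY
    · exact D.prop_of_iso (shiftNegShift B (1 : ℤ)).symm hB
  · ext X
    exact D.prop_iff_of_iso ((shiftFunctorZero C ℤ).app X)

end CategoryTheory

/-! ### Symmetry of shifts, orthogonality and adjacency -/

namespace CategoryTheory

section

variable {C : Type u} [Category.{v} C] [HasShift C ℤ]

lemma ObjectProperty.negativeShifts_op (𝒬 : ObjectProperty C) :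
    𝒬.op.negativeShifts = 𝒬.positiveShifts.op := by
  have (Q : C) (i : ℤ) : Nonempty ((op Q)⟦-i⟧ ≅ op (Q⟦i⟧)) :=
    ⟨(shiftFunctorOpIso C (-i) i (by lia)).app (op Q)⟩
  ext Y
  constructor
  · rintro ⟨i, hi, Q, hQ, ⟨e⟩⟩
    obtain ⟨e'⟩ := this Q.unop i
    exact ⟨i, hi, Q.unop, hQ, ⟨(e ≪≫ e').unop.symm⟩⟩
  · rintro ⟨i, hi, Q, hQ, ⟨e⟩⟩
    obtain ⟨e'⟩ := this Q i
    exact ⟨i, hi, op Q, hQ, ⟨e.symm.op ≪≫ e'.symm⟩⟩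

end

section

variable {C : Type u} [Category.{v} C] [Preadditive C]

lemma ObjectProperty.rightOrthogonal_isClosedUnderLimitsOfShape (𝒮 : ObjectProperty C)
    (J : Type*) : 𝒮.rightOrthogonal.IsClosedUnderLimitsOfShape (Discrete J) where
  limitsOfShape_le := by
    rintro Y ⟨p⟩ X f hX
    refine p.isLimit.hom_ext fun j => ?_
    rw [zero_comp]
    exact p.prop_diag_obj j _ hX

lemma ObjectProperty.essentiallySmall_brownComenetzDuals (𝒮 : ObjectProperty C)
    [ObjectProperty.Small.{v} 𝒮] (h𝒮 : ∀ P, 𝒮 P → ∃ X, IsBrownComenetzDual P X) :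
    ObjectProperty.EssentiallySmall.{v} 𝒮.brownComenetzDuals := by
  choose D hD using h𝒮
  refine ⟨ObjectProperty.ofObj fun i : Subtype 𝒮 => D i.1 i.2, inferInstance, ?_⟩
  rintro X ⟨P, hP, hX⟩
  exact ⟨_, ObjectProperty.ofObj_apply _ (⟨P, hP⟩ : Subtype 𝒮), hX.nonempty_iso (hD P hP)⟩

variable [HasShift C ℤ]

variable [∀ n : ℤ, (shiftFunctor C n).Additive]

lemma forall_shift_hom_comp_eq_zero_iff (P : C) {M N : C} (h : M ⟶ N) (i : ℤ) :
    (∀ g : P⟦i⟧ ⟶ M, g ≫ h = 0) ↔ ∀ g : P ⟶ M⟦-i⟧, g ≫ h⟦-i⟧' = 0 := by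
  let e := shiftFunctorCompIsoId C (-i) i (by lia)
  have key (g : P ⟶ M⟦-i⟧) : (g ≫ h⟦-i⟧')⟦i⟧' ≫ e.hom.app N = (g⟦i⟧' ≫ e.hom.app M) ≫ h := by
    have := e.hom.naturality h
    rw [Functor.map_comp, Category.assoc, Category.assoc]
    exact congr_arg (_ ≫ ·) this
  constructor
  · intro H g
    apply (shiftFunctor C i).map_injective
    rw [← cancel_mono (e.hom.app N), key, H, Functor.map_zero]
    exact zero_comp.symm
  · intro H g
    obtain ⟨g', hg'⟩ := (shiftFunctor C i).map_surjective (g ≫ e.inv.app M)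
    have : g'⟦i⟧' ≫ e.hom.app M = g := by
      rw [hg', Category.assoc, Iso.inv_hom_id_app]; exact Category.comp_id _
    rw [← this, ← key, H, Functor.map_zero]
    exact zero_comp

lemma forall_hom_shift_comp_eq_zero_iff (Q : C) {M N : C} (h : M ⟶ N) (i : ℤ) :
    (∀ g : N ⟶ Q⟦i⟧, h ≫ g = 0) ↔ ∀ g : N⟦-i⟧ ⟶ Q, h⟦-i⟧' ≫ g = 0 := by
  let e := shiftFunctorCompIsoId C (-i) i (by lia)
  have key (g : N⟦-i⟧ ⟶ Q) : (h⟦-i⟧' ≫ g)⟦i⟧' = e.hom.app M ≫ h ≫ e.inv.app N ≫ g⟦i⟧' := by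
    have := e.hom.naturality_assoc h (e.inv.app N ≫ g⟦i⟧')
    rw [Functor.map_comp]
    refine Eq.trans ?_ this
    rw [Iso.hom_inv_id_app_assoc]
    rfl
  constructor
  · intro H g
    apply (shiftFunctor C i).map_injective
    rw [key, H, Functor.map_zero, comp_zero]
  · intro H g
    obtain ⟨g', hg'⟩ := (shiftFunctor C i).map_surjective (e.hom.app N ≫ g)
    have := key g'
    rw [hg', H, Functor.map_zero, Iso.inv_hom_id_app_assoc] at this
    exact ((cancel_epi (e.hom.app M)).1 (comp_zero.trans this)).symm

/-- The positive shifts of a class and of the class of its duals are symmetric. -/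
lemma ObjectProperty.isSymmetricTo_positiveShifts (𝒮 : ObjectProperty C)
    (h : ∀ P, 𝒮 P → ∃ X, IsBrownComenetzDual P X) :
    𝒮.positiveShifts.IsSymmetricTo 𝒮.brownComenetzDuals.positiveShifts := by
  have key (i : ℤ) {P Q : C} (hQ : IsBrownComenetzDual P Q) {M N : C} (f : M ⟶ N) :
      (∀ g : P⟦i⟧ ⟶ M, g ≫ f = 0) ↔ ∀ g : N ⟶ Q⟦i⟧, f ≫ g = 0 := by
    rw [forall_shift_hom_comp_eq_zero_iff, hQ.comp_eq_zero_iff, forall_hom_shift_comp_eq_zero_iff]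
  ext M N f
  constructor
  · rintro hf Q ⟨i, hi, Q', ⟨P, hP, hQ⟩, ⟨e⟩⟩ g
    rw [← cancel_mono e.hom, zero_comp, Category.assoc]
    exact (key i hQ f).1 (hf ⟨i, hi, P, hP, ⟨Iso.refl _⟩⟩) _
  · rintro hf P ⟨i, hi, P', hP, ⟨e⟩⟩ g
    obtain ⟨Q, hQ⟩ := h P' hP
    rw [← cancel_epi e.inv, comp_zero, ← Category.assoc]
    exact (key i hQ f).2 (hf ⟨i, hi, Q, ⟨P', hP, hQ⟩, ⟨Iso.refl _⟩⟩) _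

end

variable {C : Type u} [Category.{v} C] [Preadditive C] [HasZeroObject C] [HasShift C ℤ]
  [∀ n : ℤ, (shiftFunctor C n).Additive] [Pretriangulated C]

/-- The left class of the weight structure that is opposite to one generated by the duals. -/
lemma WeightStructure.unop_le_of_isGeneratedBy {𝒮 : ObjectProperty C}
    (h𝒮 : ∀ P, 𝒮 P → ∃ X, IsBrownComenetzDual P X) {w : WeightStructure Cᵒᵖ}
    (hw : w.IsGeneratedBy 𝒮.brownComenetzDuals.op) :
    w.unop.le = 𝒮.positiveShifts.rightOrthogonal := by
  have hsymm := 𝒮.isSymmetricTo_positiveShifts h𝒮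
  ext X
  -- `𝟙 X` is null (conull) exactly when `X` receives no nonzero maps from the class (has none to
  -- it), so symmetry compares the two orthogonals.
  have h := iff_of_eq (congr_fun (congr_fun (congr_fun hsymm X) X) (𝟙 X))
  have hw' := iff_of_eq (congr_fun hw (op X))
  rw [ObjectProperty.negativeShifts_op] at hw'
  refine hw'.trans (Iff.trans ?_ (h.symm.trans ?_))
  · exact ⟨fun H Q hQ g => (Category.id_comp g).trans (Quiver.Hom.op_inj (H g.op hQ)),
      fun H Q g hQ => Quiver.Hom.unop_inj ((Category.id_comp _).symm.trans (H hQ g.unop))⟩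
  · exact ⟨fun H P g hP => (Category.comp_id g).symm.trans (H hP g),
      fun H P hP g => (Category.comp_id g).trans (H g hP)⟩

namespace WeightStructure

variable (w : WeightStructure C)

/-- If the left part of a decomposition of `Y⟦1⟧` maps to it by zero, then `Y` is a retract of the
right part `R`. -/
lemma ge_iff (Y : C) : w.ge Y ↔ ∀ X, w.le X → ∀ f : X ⟶ Y⟦(1 : ℤ)⟧, f = 0 := by
  refine ⟨fun hY X hX => w.orthogonal hX hY, fun hY => ?_⟩
  obtain ⟨L, R, hL, hR, f, g, h, hT⟩ := w.exists_decomposition (Y⟦(1 : ℤ)⟧)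
  obtain ⟨r, hr⟩ := distTriang_exists_desc₂ hT (𝟙 _) (by rw [hY L hL f, zero_comp])
  obtain ⟨i, rfl⟩ := (shiftFunctor C (1 : ℤ)).map_surjective g
  obtain ⟨r, rfl⟩ := (shiftFunctor C (1 : ℤ)).map_surjective r
  refine w.ge_retract.of_retract ⟨i, r, (shiftFunctor C (1 : ℤ)).map_injective ?_⟩ hR
  rw [Functor.map_comp, Functor.map_id, hr]

lemma ge_iff' (Y : C) : w.ge Y ↔ ∀ X, w.le X → ∀ f : X⟦(-1 : ℤ)⟧ ⟶ Y, f = 0 :=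
  (w.ge_iff Y).trans (forall₂_congr fun X _ =>
    (forall_shift_hom_eq_zero_iff X Y (-1) 1 rfl).symm)

lemma ge_isClosedUnderLimitsOfShape (J : Type*) :
    w.ge.IsClosedUnderLimitsOfShape (Discrete J) where
  limitsOfShape_le := by
    rintro Y ⟨p⟩
    refine (w.ge_iff' Y).2 fun X hX f => p.isLimit.hom_ext fun j => ?_
    rw [zero_comp]
    exact (w.ge_iff' _).1 (p.prop_diag_obj j) X hX _

end WeightStructure

end CategoryTheory

/-! ### Homology with values in the heart -/

namespace CategoryTheory

variable {C : Type u} [Category.{v} C] [Preadditive C] [HasZeroObject C] [HasShift C ℤ]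
  [∀ n : ℤ, (shiftFunctor C n).Additive] [Pretriangulated C] [IsTriangulated C]

namespace Triangulated.TStructure

variable (t : TStructure C)

instance (X : t.heart.FullSubcategory) : t.IsLE X.obj 0 := ⟨X.property.1⟩

instance (X : t.heart.FullSubcategory) : t.IsGE X.obj 0 := ⟨X.property.2⟩

omit [IsTriangulated C] in
/-- The cone of a morphism to an object of `t.ge 0` is in `t.ge 0` if the morphism is injective
on morphisms from `t.le 0`. -/
lemma isGE_cone {A B Z : C} [t.IsGE B 0] {f : A ⟶ B} {g : B ⟶ Z} {h : Z ⟶ A⟦(1 : ℤ)⟧}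
    (hT : Triangle.mk f g h ∈ distTriang C)
    (hf : ∀ (W : C) (y : W ⟶ A), t.IsLE W 0 → y ≫ f = 0 → y = 0) : t.IsGE Z 0 := by
  rw [t.isGE_iff_orthogonal (-1) 0 rfl]
  intro W x hW
  suffices hx : x ≫ h = 0 by
    obtain ⟨y, rfl⟩ := distTriang_exists_lift₃ hT x hx
    rw [t.zero y (-1) 0, zero_comp]
  have : t.IsLE (W⟦(-1 : ℤ)⟧) 0 := t.isLE_shift W (-1) (-1) 0
  obtain ⟨y, hy⟩ := (shiftFunctor C (1 : ℤ)).map_surjective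
    ((shiftNegShift W (1 : ℤ)).hom ≫ x ≫ h)
  have h₀ : y ≫ f = 0 := (shiftFunctor C (1 : ℤ)).map_injective (by
    rw [Functor.map_comp, hy, Category.assoc, Category.assoc, distTriang_comp₃₁ hT,
      comp_zero, comp_zero, Functor.map_zero])
  rw [hf _ y this h₀, Functor.map_zero] at hy
  exact (cancel_epi (shiftNegShift W (1 : ℤ)).hom).1 (hy.symm.trans comp_zero.symm)

/-- The cone of a monomorphism of the heart is in `t.ge 0`. -/
lemma isGE_of_mono {A B : t.heart.FullSubcategory} (f : A ⟶ B) [Mono f] {Z : C}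
    {g : B.obj ⟶ Z} {h : Z ⟶ A.obj⟦(1 : ℤ)⟧} (hT : Triangle.mk f.hom g h ∈ distTriang C) :
    t.IsGE Z 0 := by
  refine t.isGE_cone hT fun W y hW hy => ?_
  -- A map from `t.le 0` to a heart object factors through a heart object, where the monomorphism
  -- can be cancelled.
  let D : t.heart.FullSubcategory := ⟨(t.truncGE 0).obj W,
    (t.mem_heart_iff _).2 ⟨inferInstance, inferInstance⟩⟩
  let y' : D ⟶ A := ObjectProperty.homMk (t.descTruncGE y 0)
  have hy' : (t.truncGEπ 0).app _ ≫ y'.hom = y := t.π_descTruncGE y 0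
  have : y' ≫ f = 0 := by
    ext
    refine t.from_truncGE_obj_ext ?_
    change (t.truncGEπ 0).app _ ≫ y'.hom ≫ f.hom = (t.truncGEπ 0).app _ ≫ 0
    rw [reassoc_of% hy', hy, comp_zero]
  have : y' = 0 := zero_of_comp_mono f this
  rw [← hy', this]
  exact comp_zero

/-- The homology of an object of `t.ge 0` is its truncation. -/
noncomputable def heartHomologyIso (X : C) [t.IsGE X 0] :
    (t.heartHomology.obj X).obj ≅ (t.truncLE 0).obj X :=
  (asIso ((t.truncGEπ 0).app ((t.truncLE 0).obj X))).symm

lemma heartHomologyIso_naturality {X Y : C} [t.IsGE X 0] [t.IsGE Y 0] (f : X ⟶ Y) :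
    (t.heartHomology.map f).hom ≫ (t.heartHomologyIso Y).hom =
      (t.heartHomologyIso X).hom ≫ (t.truncLE 0).map f := by
  rw [← Iso.inv_comp_eq, ← Category.assoc, ← Iso.eq_comp_inv]
  exact ((t.truncGEπ 0).naturality ((t.truncLE 0).map f)).symm

/-- The comparison `Hᵗ X ⟶ X` for `X` in `t.ge 0`. -/
noncomputable def heartHomologyι (X : C) [t.IsGE X 0] : (t.heartHomology.obj X).obj ⟶ X :=
  (t.heartHomologyIso X).hom ≫ (t.truncLEι 0).app X

lemma heartHomologyι_naturality {X Y : C} [t.IsGE X 0] [t.IsGE Y 0] (f : X ⟶ Y) :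
    (t.heartHomology.map f).hom ≫ t.heartHomologyι Y = t.heartHomologyι X ≫ f := by
  have h : (t.truncLE 0).map f ≫ (t.truncLEι 0).app Y = (t.truncLEι 0).app X ≫ f :=
    (t.truncLEι 0).naturality f
  rw [heartHomologyι, heartHomologyι, ← Category.assoc, heartHomologyIso_naturality,
    Category.assoc, h, Category.assoc]

lemma exists_triangle_heartHomologyι (X : C) [t.IsGE X 0] :
    ∃ (Q : C) (q : X ⟶ Q) (h : Q ⟶ (t.heartHomology.obj X).obj⟦(1 : ℤ)⟧),
      t.IsGE Q 1 ∧ Triangle.mk (t.heartHomologyι X) q h ∈ distTriang C := by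
  let T := (t.triangleLEGT 0).obj X
  let e : T.obj₁ ≅ (t.heartHomology.obj X).obj := (t.heartHomologyIso X).symm
  have h₁ : t.heartHomologyι X ≫ 𝟙 X = e.inv ≫ T.mor₁ := Category.comp_id _
  have h₂ : T.mor₂ ≫ 𝟙 _ = 𝟙 X ≫ T.mor₂ := (Category.comp_id _).trans (Category.id_comp _).symm
  have h₃ : (T.mor₃ ≫ e.hom⟦(1 : ℤ)⟧') ≫ e.inv⟦(1 : ℤ)⟧' = 𝟙 _ ≫ T.mor₃ := by
    rw [Category.assoc, ← Functor.map_comp, e.hom_inv_id, Functor.map_id, Category.comp_id,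
      Category.id_comp]
  exact ⟨(t.truncGT 0).obj X, T.mor₂, T.mor₃ ≫ e.hom⟦(1 : ℤ)⟧', t.isGE_truncGT_obj X 0 1,
    isomorphic_distinguished _ (t.triangleLEGT_distinguished 0 X) _
      (Triangle.isoMk _ _ e.symm (Iso.refl _) (Iso.refl _) h₁ h₂ h₃)⟩

variable {t}

/-- The cone of `heartHomologyι` is in `t.ge 1`. Together with the uniqueness below, this makes `Hᵗ
X` represent `C(-, X)` on `t.le 0`. -/
lemma exists_comp_heartHomologyι {A X : C} [t.IsLE A 0] [t.IsGE X 0] (f : A ⟶ X) :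
    ∃ g : A ⟶ (t.heartHomology.obj X).obj, g ≫ t.heartHomologyι X = f := by
  obtain ⟨Q, q, h, hQ, hT⟩ := t.exists_triangle_heartHomologyι X
  exact distTriang_exists_lift₂ hT f (t.zero _ 0 1)

lemma eq_zero_of_comp_heartHomologyι {A X : C} [t.IsLE A 0] [t.IsGE X 0]
    (f : A ⟶ (t.heartHomology.obj X).obj) (hf : f ≫ t.heartHomologyι X = 0) : f = 0 := by
  rw [heartHomologyι, ← Category.assoc] at hf
  have h₁ := t.to_truncLE_obj_ext (hf.trans zero_comp.symm)
  rwa [← cancel_mono (t.heartHomologyIso X).hom, zero_comp]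

lemma hom_ext_heartHomologyι {A X : C} [t.IsLE A 0] [t.IsGE X 0]
    {f g : A ⟶ (t.heartHomology.obj X).obj}
    (h : f ≫ t.heartHomologyι X = g ≫ t.heartHomologyι X) : f = g :=
  sub_eq_zero.1 (eq_zero_of_comp_heartHomologyι _ (by rw [Preadditive.sub_comp, h, sub_self]))

end Triangulated.TStructure

end CategoryTheory

/-! ### The heart of an adjacent weight structure and injective objects -/

namespace CategoryTheory

variable {C : Type u} [Category.{v} C] [Preadditive C] [HasZeroObject C] [HasShift C ℤ]
  [∀ n : ℤ, (shiftFunctor C n).Additive] [Pretriangulated C]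

namespace WeightStructure

open TStructure

variable {t : TStructure C} {w : WeightStructure C}

instance heart_isStableUnderRetracts : w.heart.IsStableUnderRetracts where
  of_retract r h := ⟨w.le_retract.of_retract r h.1, w.ge_retract.of_retract r h.2⟩

namespace IsRightAdjacent

variable (hwt : w.IsRightAdjacent t)
include hwt

lemma isGE {X : C} (hX : w.heart X) : t.IsGE X 0 := ⟨by rw [← hwt]; exact hX.1⟩

lemma le_of_isGE (X : C) [t.IsGE X 0] : w.le X := by
  rw [hwt]; exact t.ge_of_isGE X 0

lemma hom_shift_eq_zero {X Y : C} [t.IsGE X 0] (hY : w.ge Y) (f : X ⟶ Y⟦(1 : ℤ)⟧) : f = 0 :=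
  w.orthogonal (hwt.le_of_isGE X) hY f

lemma hom_eq_zero {X Y : C} [t.IsGE X 1] (hY : w.ge Y) (f : X ⟶ Y) : f = 0 := by
  have := t.isGE_shift X 1 1 0
  exact (shiftFunctor C (1 : ℤ)).map_injective
    ((hwt.hom_shift_eq_zero hY _).trans (Functor.map_zero _ _ _).symm)

variable [IsTriangulated C]

/-- The homology of an object of the heart of a right adjacent weight structure is injective. -/
theorem injective_heartHomology {X : C} (hX : w.heart X) : Injective (t.heartHomology.obj X) where
  factors {A B} a f _ := by
    have := hwt.isGE hX
    obtain ⟨Z, g, h, hT⟩ := distinguished_cocone_triangle f.hom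
    have := t.isGE_of_mono f hT
    obtain ⟨y, hy⟩ := distTriang_exists_extension hT (a.hom ≫ t.heartHomologyι X)
      (hwt.hom_shift_eq_zero hX.2)
    obtain ⟨b, rfl⟩ := exists_comp_heartHomologyι (t := t) y
    refine ⟨ObjectProperty.homMk b, ?_⟩
    ext
    exact hom_ext_heartHomologyι (by rw [← hy, ← Category.assoc]; rfl)

/-- The difference factors through the cone of `Hᵗ X ⟶ X`, which lies in `t.ge 1` and so has no maps
to `w.ge`. -/
lemma heartHomology_map_injective {X Y : C} (hX : w.heart X) (hY : w.heart Y) {f₁ f₂ : X ⟶ Y}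
    (hf : t.heartHomology.map f₁ = t.heartHomology.map f₂) : f₁ = f₂ := by
  have := hwt.isGE hX
  have := hwt.isGE hY
  obtain ⟨Q, q, h, hQ, hT⟩ := t.exists_triangle_heartHomologyι X
  obtain ⟨g, hg⟩ := distTriang_exists_desc₂ hT (f₁ - f₂) (by
    rw [Preadditive.comp_sub, ← heartHomologyι_naturality, ← heartHomologyι_naturality, hf,
      sub_self])
  rw [← sub_eq_zero, ← hg, hwt.hom_eq_zero hY.2 g, comp_zero]

/-- The obstruction to extending `Hᵗ X ⟶ Hᵗ Y ⟶ Y` along `Hᵗ X ⟶ X` is a map from `t.ge 1` to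
`Y⟦1⟧`, hence zero. -/
lemma heartHomology_map_surjective {X Y : C} (hX : w.heart X) (hY : w.heart Y)
    (φ : t.heartHomology.obj X ⟶ t.heartHomology.obj Y) :
    ∃ f : X ⟶ Y, t.heartHomology.map f = φ := by
  have := hwt.isGE hX
  have := hwt.isGE hY
  obtain ⟨Q, q, h, hQ, hT⟩ := t.exists_triangle_heartHomologyι X
  have := t.isGE_of_ge Q 0 1
  obtain ⟨f, hf⟩ := distTriang_exists_extension hT (φ.hom ≫ t.heartHomologyι Y)
    (hwt.hom_shift_eq_zero hY.2)
  refine ⟨f, ?_⟩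
  ext
  exact hom_ext_heartHomologyι (by rw [heartHomologyι_naturality, hf])

/-- Every injective object of the heart of `t` is the homology of an object of the heart of a right
adjacent weight structure, if idempotents split. -/
lemma exists_heartHomology_iso
    (hC : ∀ {R : C} (e : R ⟶ R), e ≫ e = e →
      ∃ (X : C) (i : X ⟶ R) (p : R ⟶ X), i ≫ p = 𝟙 X ∧ p ≫ i = e)
    (J : t.heart.FullSubcategory) [Injective J] :
    ∃ X, w.heart X ∧ Nonempty (t.heartHomology.obj X ≅ J) := by
  -- Unshifted, this is `J ⟶ R ⟶ L` with `J` and `L` in `t.ge 0`, so `R` is in the heart of `w`.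
  obtain ⟨L, R, hL, hR, f, g, h, hT⟩ := w.exists_decomposition (J.obj⟦(1 : ℤ)⟧)
  obtain ⟨u, rfl⟩ := (shiftFunctor C (1 : ℤ)).map_surjective g
  rw [hwt] at hL
  have hL' : t.IsGE L 0 := ⟨hL⟩
  have hR' : t.IsGE R 0 := by
    have h₁ : t.IsGE (J.obj⟦(1 : ℤ)⟧) (-1) := t.isGE_shift J.obj 0 1 (-1)
    have h₂ : t.IsGE (L⟦(1 : ℤ)⟧) (-1) := t.isGE_shift L 0 1 (-1)
    have : t.IsGE (R⟦(1 : ℤ)⟧) (-1) := t.isGE₂ _ (rot_of_distTriang _ hT) (-1) h₁ h₂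
    exact t.isGE_of_shift R 0 1 (-1)
  have hRw : w.heart R := ⟨hwt.le_of_isGE R, hR⟩
  obtain ⟨m, hm⟩ := exists_comp_heartHomologyι (t := t) u
  let m' : J ⟶ t.heartHomology.obj R := ObjectProperty.homMk m
  -- The fibre `L⟦-1⟧` of `J ⟶ R` is in `t.ge 1`, so it receives no maps from the heart.
  have hmono : Mono m' := Preadditive.mono_of_cancel_zero _ fun {K} k hk => by
    have hk' : k.hom ≫ u = 0 := by
      rw [← hm, ← Category.assoc]
      exact (congr_arg (·.hom ≫ t.heartHomologyι R) hk).trans zero_comp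
    obtain ⟨y, hy⟩ := distTriang_exists_lift₂ hT (k.hom⟦(1 : ℤ)⟧')
      (by rw [← Functor.map_comp, hk', Functor.map_zero])
    have : t.IsLE (K.obj⟦(1 : ℤ)⟧) (-1) := t.isLE_shift K.obj 0 1 (-1)
    ext
    refine (shiftFunctor C (1 : ℤ)).map_injective ?_
    rw [← hy, t.zero y (-1) 0, zero_comp]
    exact (Functor.map_zero _ _ _).symm
  let r : t.heartHomology.obj R ⟶ J := Injective.factorThru (𝟙 J) m'
  have hr : m' ≫ r = 𝟙 J := Injective.comp_factorThru _ _
  -- The idempotent of `Hᵗ R` with image `J` lifts to an idempotent of `R` by full faithfulness;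
  -- splitting it in `C` gives `X`.
  obtain ⟨e, he⟩ := hwt.heartHomology_map_surjective hRw hRw (r ≫ m')
  have hee : e ≫ e = e := hwt.heartHomology_map_injective hRw hRw (by
    rw [Functor.map_comp, he, Category.assoc, ← Category.assoc m', hr, Category.id_comp])
  obtain ⟨X, i, p, hip, hpi⟩ := hC e hee
  refine ⟨X, heart_isStableUnderRetracts.of_retract ⟨i, p, hip⟩ hRw,
    ⟨⟨t.heartHomology.map i ≫ r, m' ≫ t.heartHomology.map p, ?_, ?_⟩⟩⟩
  · rw [Category.assoc, ← Category.assoc r, ← he, ← Functor.map_comp, ← Functor.map_comp, ← hpi,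
      Category.assoc, hip, Category.comp_id, hip, Functor.map_id]
  · rw [Category.assoc, ← Category.assoc _ _ r, ← Functor.map_comp, hpi, he, Category.assoc, hr,
      Category.comp_id, hr]

/-- The homology functor identifies the heart of the weight structure with the injective objects
of the heart of the t-structure. -/
theorem isEquivalence_heartHomology
    (hC : ∀ {R : C} (e : R ⟶ R), e ≫ e = e →
      ∃ (X : C) (i : X ⟶ R) (p : R ⟶ X), i ≫ p = 𝟙 X ∧ p ≫ i = e)
    (h : ∀ X : w.heart.FullSubcategory, Injective ((w.heart.ι ⋙ t.heartHomology).obj X)) :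
    ((isInjective t.heart.FullSubcategory).lift (w.heart.ι ⋙ t.heartHomology) h).IsEquivalence where
  faithful := ⟨fun {X Y f g} hfg => by
    ext1
    exact hwt.heartHomology_map_injective X.property Y.property (congr_arg (·.hom) hfg)⟩
  full := ⟨fun {X Y} φ => by
    obtain ⟨f, hf⟩ := hwt.heartHomology_map_surjective X.property Y.property φ.hom
    refine ⟨ObjectProperty.homMk f, ?_⟩
    ext1
    exact hf⟩
  essSurj := ⟨fun J => by
    have : Injective J.obj := J.property
    obtain ⟨X, hX, ⟨e⟩⟩ := hwt.exists_heartHomology_iso hC J.obj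
    exact ⟨⟨X, hX⟩, ⟨ObjectProperty.isoMk _ e⟩⟩⟩

end IsRightAdjacent

end WeightStructure

end CategoryTheory

/-! ### The injective cogenerator -/

namespace CategoryTheory

variable {C : Type u} [Category.{v} C] [Preadditive C] [HasZeroObject C] [HasShift C ℤ]
  [∀ n : ℤ, (shiftFunctor C n).Additive] [Pretriangulated C]

namespace Triangulated.TStructure.IsGeneratedBy

variable {t : TStructure C} {𝒮 : ObjectProperty C} (ht : t.IsGeneratedBy 𝒮)
include ht

lemma isGE_zero_iff (X : C) :
    t.IsGE X 0 ↔ ∀ P, 𝒮 P → ∀ i : ℤ, 0 < i → ∀ f : P⟦i⟧ ⟶ X, f = 0 := by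
  rw [← t.ge_iff_isGE, show t.ge 0 = _ from ht]
  refine ⟨fun h P hP i hi f => h f ⟨i, hi, P, hP, ⟨Iso.refl _⟩⟩, ?_⟩
  rintro h Q f ⟨i, hi, P, hP, ⟨e⟩⟩
  rw [← cancel_epi e.inv, h P hP i hi (e.inv ≫ f), comp_zero]

lemma shift_hom_eq_zero {X P : C} [t.IsGE X 0] (hP : 𝒮 P) (i : ℤ) (hi : 0 < i)
    (f : P⟦i⟧ ⟶ X) : f = 0 :=
  (ht.isGE_zero_iff X).1 inferInstance P hP i hi f

/-- Lowering a positive shift by one gives a positive shift again unless `i = 1`. Thus only the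
generators themselves need an extra hypothesis. -/
lemma shift_shift_neg_one_cases (X : C) {P : C} [t.IsGE X 0] (hP : 𝒮 P) (i : ℤ) (hi : 0 < i) :
    Nonempty (P⟦i⟧⟦(-1 : ℤ)⟧ ≅ P) ∨ ∀ f : P⟦i⟧⟦(-1 : ℤ)⟧ ⟶ X, f = 0 := by
  obtain rfl | hi' : i = 1 ∨ 1 < i := by lia
  · exact Or.inl ⟨shiftShiftNeg P (1 : ℤ)⟩
  · exact Or.inr ((forall_hom_iso_eq_zero_iff
      ((shiftFunctorAdd' C i (-1) (i - 1) (by lia)).app P) (Iso.refl X)).1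
        (ht.shift_hom_eq_zero hP (i - 1) (by lia)))

lemma isGE_one {X : C} [t.IsGE X 0] (hX : ∀ P, 𝒮 P → ∀ f : P ⟶ X, f = 0) : t.IsGE X 1 := by
  suffices t.IsGE (X⟦(1 : ℤ)⟧) 0 from t.isGE_of_shift X 1 1 0
  refine (ht.isGE_zero_iff _).2 fun P hP i hi =>
    (forall_shift_hom_eq_zero_iff _ _ (-1) 1 rfl).1 ?_
  obtain ⟨⟨e⟩⟩ | h := ht.shift_shift_neg_one_cases X hP i hi
  · exact (forall_hom_iso_eq_zero_iff e (Iso.refl X)).2 (hX P hP)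
  · exact h

/-- The cone of a morphism in `t.ge 0` is in `t.ge 0` if the morphism is injective on morphisms
from the generators. -/
lemma isGE_cone {X Y Z : C} [t.IsGE X 0] [t.IsGE Y 0] {m : X ⟶ Y} {q : Y ⟶ Z}
    {h : Z ⟶ X⟦(1 : ℤ)⟧} (hT : Triangle.mk m q h ∈ distTriang C)
    (hm : ∀ P, 𝒮 P → ∀ u : P ⟶ X, u ≫ m = 0 → u = 0) : t.IsGE Z 0 := by
  refine (ht.isGE_zero_iff Z).2 fun P hP i hi g => ?_
  suffices hg : g ≫ h = 0 by
    obtain ⟨y, rfl⟩ := distTriang_exists_lift₃ hT g hg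
    rw [ht.shift_hom_eq_zero hP i hi y, zero_comp]
  obtain ⟨y, hy⟩ := (shiftFunctor C (1 : ℤ)).map_surjective
    ((shiftNegShift (P⟦i⟧) (1 : ℤ)).hom ≫ g ≫ h)
  have h₀ : y ≫ m = 0 := (shiftFunctor C (1 : ℤ)).map_injective (by
    rw [Functor.map_comp, hy, Category.assoc, Category.assoc, distTriang_comp₃₁ hT,
      comp_zero, comp_zero, Functor.map_zero])
  have h₁ : y = 0 := by
    obtain ⟨⟨e⟩⟩ | h' := ht.shift_shift_neg_one_cases X hP i hi
    · rw [← cancel_epi e.inv, comp_zero]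
      exact hm P hP _ (by rw [Category.assoc, h₀, comp_zero])
    · exact h' y
  rw [h₁, Functor.map_zero] at hy
  exact (cancel_epi (shiftNegShift (P⟦i⟧) (1 : ℤ)).hom).1 (hy.symm.trans comp_zero.symm)

end Triangulated.TStructure.IsGeneratedBy

open TStructure

namespace WeightStructure.IsRightAdjacent

variable {t : TStructure C} {w : WeightStructure C} (hwt : w.IsRightAdjacent t)
  {𝒮 : ObjectProperty C} (ht : t.IsGeneratedBy 𝒮)
include hwt ht

lemma ge_of_isBrownComenetzDual {P D : C} (hP : 𝒮 P) (hD : IsBrownComenetzDual P D) :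
    w.ge D := by
  refine (w.ge_iff' D).2 fun X hX => (hD.eq_zero_iff _).1 ?_
  rw [hwt] at hX
  have : t.IsGE X 0 := ⟨hX⟩
  exact (forall_shift_hom_eq_zero_iff P X 1 (-1) rfl).1 (ht.shift_hom_eq_zero hP 1 one_pos)

/-- An object of the heart through which all morphisms from `w.le` to a given dual factor. -/
lemma exists_heart_approximation {P D : C} (hP : 𝒮 P) (hD : IsBrownComenetzDual P D) :
    ∃ (L : C) (f : L ⟶ D), w.heart L ∧ ∀ (X : C) (g : X ⟶ D), w.le X → ∃ a, a ≫ f = g := by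
  obtain ⟨L, R, hL, hR, f, g, h, hT⟩ := w.exists_decomposition D
  refine ⟨L, f, ⟨hL, (w.ge_iff L).2 fun X hX x => ?_⟩, fun X x hX =>
    distTriang_exists_lift₂ hT x (w.orthogonal hX hR _)⟩
  -- `L` is an extension of `D` by `R`, both in `w.ge`: `x` dies in `D⟦1⟧`, hence comes from `R⟦1⟧`.
  obtain ⟨y, rfl⟩ := distTriang_exists_lift₁ hT x
    (w.orthogonal hX (hwt.ge_of_isBrownComenetzDual ht hP hD) _)
  rw [w.orthogonal hX hR y, zero_comp]

/-- An object of the heart through which all morphisms from `w.le` to the duals factor. -/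
lemma exists_heart_cogenerator [HasProducts.{v} C] [ObjectProperty.Small.{v} 𝒮]
    (h𝒮 : ∀ P, 𝒮 P → ∃ D, IsBrownComenetzDual P D) :
    ∃ I : C, w.heart I ∧ ∀ P, 𝒮 P → ∃ (D : C) (b : I ⟶ D), IsBrownComenetzDual P D ∧
      ∀ (X : C) (g : X ⟶ D), w.le X → ∃ a, a ≫ b = g := by
  choose D hD using h𝒮
  choose L f hL hf using fun P hP => hwt.exists_heart_approximation ht hP (hD P hP)
  let e := equivShrink.{v} (Subtype 𝒮)
  let L' : Shrink.{v} (Subtype 𝒮) → C := fun i => L _ (e.symm i).2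
  have h₁ : w.le.IsClosedUnderLimitsOfShape (Discrete (Shrink.{v} (Subtype 𝒮))) := by
    rw [show w.le = _ from hwt, show t.ge 0 = _ from ht]
    exact ObjectProperty.rightOrthogonal_isClosedUnderLimitsOfShape _ _
  have h₂ := w.ge_isClosedUnderLimitsOfShape (Shrink.{v} (Subtype 𝒮))
  refine ⟨∏ᶜ L', ⟨w.le.prop_pi _ fun i => (hL _ _).1, w.ge.prop_pi _ fun i => (hL _ _).2⟩,
    fun P hP => ?_⟩
  obtain ⟨i, hi⟩ := e.symm.surjective ⟨P, hP⟩
  obtain rfl : P = (e.symm i).1 := by rw [hi]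
  refine ⟨_, Pi.π L' i ≫ f _ (e.symm i).2, hD _ (e.symm i).2, fun X g hX => ?_⟩
  obtain ⟨a, ha⟩ := hf _ (e.symm i).2 X g hX
  -- A projection of the product is split by zeros in the other factors, so the factorization
  -- through one factor passes to the product.
  exact ⟨a ≫ section_ (Pi.π L' i), by
    rw [Category.assoc, ← Category.assoc (section_ _), IsSplitEpi.id]
    exact (congr_arg (a ≫ ·) (Category.id_comp _)).trans ha⟩

variable {I : C} (hI' : ∀ P, 𝒮 P → ∃ (D : C) (b : I ⟶ D),
  IsBrownComenetzDual P D ∧ ∀ (X : C) (g : X ⟶ D), w.le X → ∃ a, a ≫ b = g)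
include hI'

lemma isGE_one_of_hom_eq_zero {X : C} [t.IsGE X 0] (hX : ∀ u : X ⟶ I, u = 0) : t.IsGE X 1 :=
  ht.isGE_one fun P hP => by
    obtain ⟨D, b, hD, hb⟩ := hI' P hP
    refine (hD.eq_zero_iff X).2 fun g => ?_
    obtain ⟨a, rfl⟩ := hb X g (hwt.le_of_isGE X)
    rw [hX a, zero_comp]

variable (hI : w.heart I)
include hI

/-- Every object of the heart is a retract of a product of copies of a cogenerator. -/
lemma exists_retract_product [HasProducts.{v} C] {X : C} (hX : w.heart X) :
    ∃ (J : Type v) (c : Fan fun _ : J => I) (_ : IsLimit c), Nonempty (Retract X c.pt) := by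
  let Y : C := ∏ᶜ fun _ : X ⟶ I => I
  have : t.IsGE X 0 := hwt.isGE hX
  have : t.IsGE Y 0 := by
    refine (ht.isGE_zero_iff Y).2 fun P hP i hi g => Limits.Pi.hom_ext _ _ fun j => ?_
    have := hwt.isGE hI
    rw [ht.shift_hom_eq_zero hP i hi (g ≫ _), zero_comp]
  let m : X ⟶ Y := Pi.lift fun a => a
  obtain ⟨Q, q, h, hT⟩ := distinguished_cocone_triangle m
  have : t.IsGE Q 0 := by
    -- Every map from `X` to a dual factors through `I`, hence extends along `m`; dually `m` is
    -- injective on maps from `P`. The cone is thus in `t.ge 0`, and `m` splits.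
    refine ht.isGE_cone hT fun P hP => ?_
    obtain ⟨D, b, hD, hb⟩ := hI' P hP
    refine hD.eq_zero_of_comp_eq_zero m fun g => ?_
    obtain ⟨a, ha⟩ := hb X g hX.1
    exact ⟨Pi.π _ a ≫ b, by rw [← ha, ← Category.assoc, Pi.lift_π]⟩
  obtain ⟨r, hr⟩ := distTriang_exists_extension hT (𝟙 X) (hwt.hom_shift_eq_zero hX.2)
  exact ⟨X ⟶ I, _, productIsProduct _, ⟨m, r, hr⟩⟩

/-- The homology of a cogenerator of the heart is a coseparator. -/
theorem isCoseparator_heartHomology [IsTriangulated C] :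
    IsCoseparator (t.heartHomology.obj I) := by
  have := hwt.isGE hI
  refine (Preadditive.isCoseparator_iff _).2 fun A B f hf => ?_
  obtain ⟨F, a, p, hF⟩ := distinguished_cocone_triangle₁ f.hom
  have hK : Triangle.mk ((t.truncLEι 0).app F) ((t.truncGTπ 0).app F) ((t.truncGTδLE 0).app F) ∈
    distTriang C := t.triangleLEGT_distinguished 0 F
  -- The truncation of the fibre `F` plays the role of the kernel of `f`, and `E` that of its image.
  -- Showing that `E` has no maps to `I` puts it in `t.ge 1`, so `A ⟶ E` vanishes and with it `f`.
  obtain ⟨E, c, δ, hE⟩ := distinguished_cocone_triangle ((t.truncLEι 0).app F ≫ a)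
  have : t.IsGE E 0 := by
    refine t.isGE_cone hE fun W y hW hy => t.to_truncLE_obj_ext ?_
    refine (shiftFunctor C (1 : ℤ)).map_injective ?_
    have : t.IsLE (W⟦(1 : ℤ)⟧) (-1) := t.isLE_shift W 0 1 (-1)
    obtain ⟨z, hz⟩ := distTriang_exists_lift₁ hF ((y ≫ (t.truncLEι 0).app F)⟦(1 : ℤ)⟧')
      (by rw [← Functor.map_comp, Category.assoc]
          exact (congr_arg _ hy).trans (Functor.map_zero _ _ _))
    rw [← hz, t.zero z (-1) 0, zero_comp, zero_comp, Functor.map_zero]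
  have hEI (u : E ⟶ I) : u = 0 := by
    have h₁ : a ≫ c ≫ u = 0 := by
      obtain ⟨x, hx⟩ := distTriang_exists_desc₂ hK (a ≫ c ≫ u) (by
        rw [← Category.assoc, ← Category.assoc, distTriang_comp₁₂ hE, zero_comp])
      have : t.IsGE ((t.truncGT 0).obj F) 1 := t.isGE_truncGT_obj F 0 1
      rw [← hx, hwt.hom_eq_zero hI.2 x, comp_zero]
    obtain ⟨v, hv⟩ := distTriang_exists_desc₂ hF (c ≫ u) h₁
    obtain ⟨v', rfl⟩ := exists_comp_heartHomologyι (t := t) v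
    have h₂ : c ≫ u = 0 := by
      rw [← hv, ← Category.assoc]
      exact (congr_arg (·.hom ≫ t.heartHomologyι I) (hf (ObjectProperty.homMk v'))).trans zero_comp
    obtain ⟨x, rfl⟩ := distTriang_exists_desc₃ hE u h₂
    have : t.IsLE (((t.truncLE 0).obj F)⟦(1 : ℤ)⟧) (-1) := t.isLE_shift _ 0 1 (-1)
    rw [t.zero x (-1) 0, comp_zero]
  have := hwt.isGE_one_of_hom_eq_zero ht hI' hEI
  obtain ⟨x, hx⟩ := distTriang_exists_desc₂ hE f.hom (by
    rw [Category.assoc, distTriang_comp₁₂ hF, comp_zero])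
  ext
  rw [← hx, t.zero c 0 1, zero_comp]
  rfl

end WeightStructure.IsRightAdjacent

end CategoryTheory

/-! ### Consequences of Brown representability -/

namespace CategoryTheory

variable {C : Type u} [Category.{v} C] [Preadditive C] [HasZeroObject C] [HasShift C ℤ]
  [∀ n : ℤ, (shiftFunctor C n).Additive] [Pretriangulated C]

lemma BrownRepresentability.hasCoproducts_op [HasCoproducts.{v} C]
    (hC : BrownRepresentability C) : HasCoproducts.{v} Cᵒᵖ := by
  have := hC.hasProducts
  infer_instance

lemma WeightStructure.isRightAdjacent_unop {𝒮 : ObjectProperty C}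
    (h𝒮 : ∀ P, 𝒮 P → ∃ X, IsBrownComenetzDual P X) {t : TStructure C} (ht : t.IsGeneratedBy 𝒮)
    {w : WeightStructure Cᵒᵖ} (hw : w.IsGeneratedBy 𝒮.brownComenetzDuals.op) :
    w.unop.IsRightAdjacent t :=
  (w.unop_le_of_isGeneratedBy h𝒮 hw).trans ht.symm

/-- The duals of a small class of objects generate a weight structure on the opposite category. -/
lemma exists_weightStructure_isGeneratedBy_brownComenetzDuals [HasCoproducts.{v} Cᵒᵖ]
    (𝒮 : ObjectProperty C) [ObjectProperty.Small.{v} 𝒮]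
    (h𝒮 : ∀ P, 𝒮 P → ∃ X, IsBrownComenetzDual P X) :
    ∃ w : WeightStructure Cᵒᵖ, w.IsGeneratedBy 𝒮.brownComenetzDuals.op := by
  have := 𝒮.essentiallySmall_brownComenetzDuals h𝒮
  refine exists_weightStructure_isGeneratedBy _ ?_
  rw [ObjectProperty.negativeShifts_op]
  exact (𝒮.isSymmetricTo_positiveShifts h𝒮).isPerfect_op

/-- The weight structure that is opposite to one generated by the duals is cosmashing. -/
lemma WeightStructure.unop_le_isClosedUnderLimitsOfShape {𝒮 : ObjectProperty C}
    (h𝒮 : ∀ P, 𝒮 P → ∃ X, IsBrownComenetzDual P X)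
    {w : WeightStructure Cᵒᵖ} (hw : w.IsGeneratedBy 𝒮.brownComenetzDuals.op) (J : Type*) :
    w.unop.le.IsClosedUnderLimitsOfShape (Discrete J) := by
  rw [w.unop_le_of_isGeneratedBy h𝒮 hw]
  exact ObjectProperty.rightOrthogonal_isClosedUnderLimitsOfShape _ _

/-- The heart of a compactly generated t-structure has an injective cogenerator, if Brown
representability holds. -/
theorem BrownRepresentability.exists_injective_cogenerator [IsTriangulated C]
    [HasCoproducts.{v} C] (hC : BrownRepresentability C) {𝒮 : ObjectProperty C}
    [ObjectProperty.Small.{v} 𝒮] (h𝒮 : ∀ P, 𝒮 P → IsCompactObj P) {t : TStructure C}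
    (ht : t.IsGeneratedBy 𝒮) :
    ∃ E : t.heart.FullSubcategory, Injective E ∧ IsCoseparator E := by
  have hd : ∀ P, 𝒮 P → ∃ X, IsBrownComenetzDual P X := fun P hP => (h𝒮 P hP).exists_dual hC
  have := hC.hasCoproducts_op
  have := hC.hasProducts
  obtain ⟨w, hw⟩ := exists_weightStructure_isGeneratedBy_brownComenetzDuals 𝒮 hd
  have hwt := WeightStructure.isRightAdjacent_unop hd ht hw
  obtain ⟨I, hI, hI'⟩ := hwt.exists_heart_cogenerator ht hd
  exact ⟨_, hwt.injective_heartHomology hI, hwt.isCoseparator_heartHomology ht hI' hI⟩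

end CategoryTheory

/-! ### Localizing subcategories generated by compact objects -/

namespace CategoryTheory

section

variable {C : Type u} [Category.{v} C] [HasShift C ℤ]

/-- The class of all shifts of elements of `𝒮`. -/
def ObjectProperty.allShifts (𝒮 : ObjectProperty C) : ObjectProperty C :=
  fun X => ∃ (n : ℤ) (P : C), 𝒮 P ∧ Nonempty (X ≅ P⟦n⟧)

lemma ObjectProperty.le_allShifts (𝒮 : ObjectProperty C) : 𝒮 ≤ 𝒮.allShifts := fun P hP =>
  ⟨0, P, hP, ⟨((shiftFunctorZero C ℤ).app P).symm⟩⟩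

end

section

variable {C : Type u} [Category.{v} C] [Preadditive C]

lemma ObjectProperty.leftOrthogonal_isClosedUnderColimitsOfShape (𝒮 : ObjectProperty C)
    (J : Type*) : 𝒮.leftOrthogonal.IsClosedUnderColimitsOfShape (Discrete J) where
  colimitsOfShape_le := by
    rintro X ⟨p⟩ Y f hY
    refine p.isColimit.hom_ext fun j => ?_
    rw [comp_zero]
    exact p.prop_diag_obj j _ hY

/-- Compact objects that lie in a full subcategory closed under coproducts are compact there. -/
lemma IsCompactObj.fullSubcategory [HasCoproducts.{v} C] {L : ObjectProperty C}
    (hL : ∀ J : Type v, L.IsClosedUnderColimitsOfShape (Discrete J)) {P : L.FullSubcategory}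
    (hP : IsCompactObj P.obj) : IsCompactObj P := fun J => by
  have := hP J
  let e : L.ι ⋙ preadditiveCoyoneda.obj (op P.obj) ≅ preadditiveCoyoneda.obj (op P) :=
    NatIso.ofComponents (fun X => AddEquiv.toAddCommGrpIso
      { toFun := fun f => ObjectProperty.homMk f
        invFun := fun f => f.hom
        left_inv := fun _ => rfl
        right_inv := fun _ => rfl
        map_add' := fun _ _ => rfl }) fun f => by ext; rfl
  exact preservesColimitsOfShape_of_natIso e

variable [HasShift C ℤ]

/-- The localizing subcategory generated by `𝒮`. -/
abbrev ObjectProperty.localizing (𝒮 : ObjectProperty C) : ObjectProperty C :=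
  𝒮.allShifts.rightOrthogonal.leftOrthogonal

namespace ObjectProperty

variable (𝒮 : ObjectProperty C)

instance : 𝒮.allShifts.IsStableUnderShift ℤ where
  isStableUnderShiftBy n := ⟨fun _ ⟨m, P, hP, ⟨e⟩⟩ => ⟨m + n, P, hP,
    ⟨(shiftFunctor C n).mapIso e ≪≫ ((shiftFunctorAdd' C m n (m + n) rfl).app P).symm⟩⟩⟩

lemma le_localizing : 𝒮 ≤ 𝒮.localizing := fun P hP _ f hY => hY f (𝒮.le_allShifts P hP)

lemma forall_localizing_shift_hom_eq_zero_iff (P X : 𝒮.localizing.FullSubcategory) (n : ℤ) :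
    (∀ f : P⟦n⟧ ⟶ X, f = 0) ↔ ∀ f : P.obj⟦n⟧ ⟶ X.obj, f = 0 := by
  let e := (𝒮.localizing.ι.commShiftIso n).app P
  refine Iff.trans ?_ (forall_hom_iso_eq_zero_iff e (Iso.refl X.obj))
  exact ⟨fun h f => congr_arg (·.hom) (h (homMk f)), fun h f => by ext; exact h f.hom⟩

variable [HasCoproducts.{v} C]

instance (J : Type v) : HasColimitsOfShape (Discrete J) 𝒮.localizing.FullSubcategory :=
  have := 𝒮.allShifts.rightOrthogonal.leftOrthogonal_isClosedUnderColimitsOfShape J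
  inferInstance

lemma isCompactObj_localizing {P : 𝒮.localizing.FullSubcategory} (hP : IsCompactObj P.obj) :
    IsCompactObj P :=
  hP.fullSubcategory fun J => leftOrthogonal_isClosedUnderColimitsOfShape _ J

end ObjectProperty

end

namespace ObjectProperty

variable {C : Type u} [Category.{v} C] [Preadditive C] [HasZeroObject C] [HasShift C ℤ]
  [∀ n : ℤ, (shiftFunctor C n).Additive] [Pretriangulated C]

/-- Brown representability for the localizing subcategory generated by a set of compact objects. -/
lemma brownRepresentability_localizing [HasCoproducts.{v} C] [IsTriangulated C]
    (𝒮 : ObjectProperty C) [ObjectProperty.Small.{v} 𝒮]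
    (h𝒮 : ∀ P, 𝒮 P → IsCompactObj P) :
    BrownRepresentability 𝒮.localizing.FullSubcategory := by
  let e := equivShrink.{v} (Subtype 𝒮)
  let P (i : Shrink.{v} (Subtype 𝒮)) : 𝒮.localizing.FullSubcategory :=
    ⟨(e.symm i).1, 𝒮.le_localizing _ (e.symm i).2⟩
  have hP (i) : IsCompactObj (P i) := 𝒮.isCompactObj_localizing (h𝒮 _ (e.symm i).2)
  refine brownRepresentability_of_isCompactObj
    (G := fun i : Shrink.{v} (Subtype 𝒮) × ULift.{v} ℤ => (P i.1)⟦i.2.down⟧)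
    (fun i => (hP i.1).shift _) (fun i => ⟨(i.1, ⟨i.2.down - 1⟩),
      ⟨(shiftFunctorAdd' _ i.2.down (-1) (i.2.down - 1) (by lia)).app _⟩⟩) fun X hX => ?_
  -- `X` is right orthogonal to all shifts of the generators and, lying in the subcategory, left
  -- orthogonal to such objects; so `𝟙 X = 0`.
  refine (IsZero.iff_id_eq_zero X).2 ?_
  ext
  refine X.property _ ?_
  rintro Q f ⟨n, Q', hQ', ⟨a⟩⟩
  obtain ⟨i, hi⟩ := e.symm.surjective ⟨Q', hQ'⟩
  obtain rfl : (e.symm i).1 = Q' := by rw [hi]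
  have := (𝒮.forall_localizing_shift_hom_eq_zero_iff (P i) X n).1 (hX (i, ⟨n⟩)) (a.inv ≫ f)
  rwa [← cancel_epi a.inv, comp_zero]

end ObjectProperty

end CategoryTheory

/-! ### Descent to the localizing subcategory and the corollary -/

namespace CategoryTheory

variable {C : Type u} [Category.{v} C] [Preadditive C] [HasZeroObject C] [HasShift C ℤ]
  [∀ n : ℤ, (shiftFunctor C n).Additive] [Pretriangulated C]

namespace Triangulated.TStructure.IsGeneratedBy

variable {t : TStructure C} {𝒮 : ObjectProperty C} (ht : t.IsGeneratedBy 𝒮)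
include ht

lemma isGE_one_of_allShifts {X : C} (hX : 𝒮.allShifts.rightOrthogonal X) : t.IsGE X 1 := by
  have : t.IsGE X 0 := (ht.isGE_zero_iff X).2 fun P hP i _ f => hX f ⟨i, P, hP, ⟨Iso.refl _⟩⟩
  exact ht.isGE_one fun P hP f => hX f (𝒮.le_allShifts P hP)

/-- Objects orthogonal to all shifts of the generators lie in `t.ge 1`. Hence the subcategory
contains `t.le 0`, and the truncation triangles of its objects stay inside it. -/
lemma localizing_of_isLE (X : C) [t.IsLE X 0] : 𝒮.localizing X := fun Y f hY => by
  have := ht.isGE_one_of_allShifts hY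
  exact t.zero f 0 1

lemma hasInducedTStructure : 𝒮.localizing.HasInducedTStructure t where
  exists_triangle_zero_one A hA := by
    obtain ⟨X, Y, hX, hY, f, g, h, hT⟩ := t.exists_triangle_zero_one A
    have hX' : t.IsLE X 0 := ⟨hX⟩
    have h₁ := ht.localizing_of_isLE X
    exact ⟨X, Y, ⟨hX⟩, ⟨hY⟩, f, g, h, hT, ObjectProperty.le_isoClosure _ _ h₁,
      ObjectProperty.le_isoClosure _ _
        (𝒮.localizing.ext_of_isTriangulatedClosed₃ _ hT h₁ hA)⟩

lemma localizing [𝒮.localizing.HasInducedTStructure t] :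
    (𝒮.localizing.tStructure t).IsGeneratedBy (𝒮.inverseImage 𝒮.localizing.ι) := by
  ext X
  have h : (𝒮.localizing.tStructure t).ge 0 X ↔ _ :=
    (t.ge_iff_isGE X.obj 0).trans (ht.isGE_zero_iff X.obj)
  refine h.trans ⟨?_, fun h P hP i hi => ?_⟩
  · rintro h Q f ⟨i, hi, P, hP, ⟨e⟩⟩
    have := (𝒮.forall_localizing_shift_hom_eq_zero_iff P X i).2 (h P.obj hP i hi) (e.inv ≫ f)
    rwa [← cancel_epi e.inv, comp_zero]
  · exact (𝒮.forall_localizing_shift_hom_eq_zero_iff ⟨P, 𝒮.le_localizing P hP⟩ X i).1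
      fun f => h f ⟨i, hi, ⟨P, 𝒮.le_localizing P hP⟩, hP, ⟨Iso.refl _⟩⟩

end Triangulated.TStructure.IsGeneratedBy

/-- The heart of a compactly generated t-structure has an injective cogenerator. -/
theorem Triangulated.TStructure.IsCompactlyGenerated.exists_injective_cogenerator
    [IsTriangulated C] [HasCoproducts.{v} C] {t : TStructure C} (ht : t.IsCompactlyGenerated) :
    ∃ E : t.heart.FullSubcategory, Injective E ∧ IsCoseparator E := by
  obtain ⟨𝒮, h𝒮, hcomp, ht⟩ := ht
  have := ht.hasInducedTStructure
  have h₁ : ObjectProperty.Small.{v} (𝒮.inverseImage 𝒮.localizing.ι) :=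
    small_of_injective (β := Subtype 𝒮) (f := fun X => ⟨X.1.obj, X.2⟩) fun X Y h => by
      ext
      exact congr_arg Subtype.val h
  obtain ⟨E, hE, hE'⟩ :=
    (𝒮.brownRepresentability_localizing hcomp).exists_injective_cogenerator
      (𝒮 := 𝒮.inverseImage 𝒮.localizing.ι)
      (fun P hP => 𝒮.isCompactObj_localizing (hcomp _ hP)) ht.localizing
  -- The whole heart of `t` lies in `t.le 0`, hence in the subcategory, so the two hearts agree and
  -- the cogenerator is transported.
  let F : (𝒮.localizing.tStructure t).heart.FullSubcategory ⥤ t.heart.FullSubcategory :=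
    t.heart.lift ((𝒮.localizing.tStructure t).heart.ι ⋙ 𝒮.localizing.ι) fun X => X.property
  have : F.IsEquivalence :=
    { faithful := ⟨fun {X Y f g} h => by
        ext
        exact congr_arg (·.hom) h⟩
      full := ⟨fun {X Y} f => ⟨ObjectProperty.homMk (ObjectProperty.homMk f.hom), rfl⟩⟩
      essSurj := ⟨fun X => ⟨⟨⟨X.obj, ht.localizing_of_isLE X.obj⟩, X.property⟩,
        ⟨Iso.refl _⟩⟩⟩ }
  exact ⟨F.obj E, F.asEquivalence.map_injective_iff E |>.2 hE, hE'.of_equivalence F.asEquivalence⟩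

end CategoryTheory

theorem mainTheorem5 {C : Type u} [Category.{v} C] [Preadditive C] [HasZeroObject C]
    [HasShift C ℤ] [∀ n : ℤ, (shiftFunctor C n).Additive] [Pretriangulated C] [IsTriangulated C]
    [HasCoproducts.{v} C] (𝒮 : ObjectProperty C) :
    -- a class symmetric to some class is perfect
    (∀ 𝒬 : ObjectProperty C, 𝒮.IsSymmetricTo 𝒬 → 𝒮.IsPerfect) ∧
    -- if the duals exist, then the class is symmetric to the class of the duals
    ((∀ P, 𝒮 P → ∃ X, IsBrownComenetzDual P X) → 𝒮.IsSymmetricTo 𝒮.brownComenetzDuals) ∧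
    -- classes of compact objects under Brown representability
    (BrownRepresentability C → (∀ P, 𝒮 P → IsCompactObj P) →
      (∀ P, 𝒮 P → ∃ X, IsBrownComenetzDual P X) ∧
      𝒮.IsSymmetricTo 𝒮.brownComenetzDuals ∧
      HasCoproducts.{v} Cᵒᵖ ∧
      𝒮.brownComenetzDuals.op.IsPerfect ∧
      -- sets of compact objects
      (ObjectProperty.Small.{v} 𝒮 →
        ObjectProperty.EssentiallySmall.{v} 𝒮.brownComenetzDuals.op ∧
        (∃ t : TStructure C, t.IsGeneratedBy 𝒮) ∧
        (∃ w' : WeightStructure Cᵒᵖ, w'.IsGeneratedBy 𝒮.brownComenetzDuals.op) ∧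
        ∀ (t : TStructure C) (w' : WeightStructure Cᵒᵖ), t.IsGeneratedBy 𝒮 →
          w'.IsGeneratedBy 𝒮.brownComenetzDuals.op →
          w'.unop.IsCosmashing ∧
          (∀ J : Type v, w'.unop.heart.IsClosedUnderLimitsOfShape (Discrete J)) ∧
          w'.unop.IsRightAdjacent t ∧
          -- the homology functor identifies the heart of the weight structure with the
          -- injective objects of the heart of the t-structure
          (∃ h : ∀ X : w'.unop.heart.FullSubcategory,
              Injective ((w'.unop.heart.ι ⋙ t.heartHomology).obj X),
            ((isInjective t.heart.FullSubcategory).lift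
              (w'.unop.heart.ι ⋙ t.heartHomology) h).IsEquivalence) ∧
          ∃ I : C, w'.unop.heart I ∧
            (∀ X, w'.unop.heart X → ∃ (J : Type v) (c : Fan fun _ : J => I) (_ : IsLimit c),
              Nonempty (Retract X c.pt)) ∧
            Injective (t.heartHomology.obj I) ∧ IsCoseparator (t.heartHomology.obj I))) ∧
    -- hearts of compactly generated t-structures
    (∀ t : TStructure C, t.IsCompactlyGenerated →
      ∃ E : t.heart.FullSubcategory, Injective E ∧ IsCoseparator E) := by

  refine ⟨fun 𝒬 h => h.isPerfect, 𝒮.isSymmetricTo_brownComenetzDuals, fun hC h𝒮 => ?_,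
    fun t ht => ht.exists_injective_cogenerator⟩
  have hd : ∀ P, 𝒮 P → ∃ X, IsBrownComenetzDual P X := fun P hP => (h𝒮 P hP).exists_dual hC
  have hsymm := 𝒮.isSymmetricTo_brownComenetzDuals hd
  have hcop := hC.hasCoproducts_op
  have hprod := hC.hasProducts
  refine ⟨hd, hsymm, hcop, hsymm.isPerfect_op, fun hsmall => ?_⟩
  have hess := 𝒮.essentiallySmall_brownComenetzDuals hd
  refine ⟨inferInstance, exists_tStructure_isGeneratedBy 𝒮 h𝒮,
    exists_weightStructure_isGeneratedBy_brownComenetzDuals 𝒮 hd, fun t w ht hw => ?_⟩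
  have hwt := WeightStructure.isRightAdjacent_unop hd ht hw
  have hle (J : Type v) := w.unop_le_isClosedUnderLimitsOfShape hd hw J
  obtain ⟨I, hI, hI'⟩ := hwt.exists_heart_cogenerator ht hd
  refine ⟨⟨hprod, hle⟩, fun J => ?_, hwt,
    ⟨fun X => hwt.injective_heartHomology X.property,
      hwt.isEquivalence_heartHomology hC.exists_splitting _⟩,
    I, hI, fun X hX => hwt.exists_retract_product ht hI' hI hX,
    hwt.injective_heartHomology hI, hwt.isCoseparator_heartHomology ht hI' hI⟩
  have := hle J
  have := w.unop.ge_isClosedUnderLimitsOfShape J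
  exact ⟨fun X ⟨p⟩ => ⟨(p.ofLE fun _ h => h.1).prop, (p.ofLE fun _ h => h.2).prop⟩⟩
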